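/- Let $d\ge 1$, $q\ge 1$, let $\rho$ be a Borel probability measure on $[0,1]$ and let $E(\mathbb Z^d)$ be the set of nearest-neighbour edges of $\mathbb Z^d$. Let $J=(J_e)_{e\in E(\mathbb Z^d)}$ be i.i.d. with law $\rho$; write $\mathbb E$ for the corresponding expectation. For $\beta\ge 0$ put $p(t)=1-\exp(-\beta t)$. For $N\ge 0$ let $E_N$ be the (finite) set of edges with at least one endpoint in $\hat\Lambda_N=\{-N,\dots,N\}^d$. For a boundary condition $\pi\in\{f,w\}$ (free: all edges outside $E_N$ are closed; wired: all edges outside $E_N$ are open) let $\Phi^{J,\pi}_{\hat\Lambda_N}$ be the random cluster (FK) measure on the configurations $\omega:E(\mathbb Z^d)\to\{0,1\}$ that vanish outside $E_N$, \[ \Phi^{J,\pi}_{\hat\Lambda_N}(\{\omega\})=\frac{1}{Z^{J,\pi}_{N}}\prod_{e\in E_N}p(J_e)^{\omega_e}(1-p(J_e))^{1-\omega_e}\; q^{C^{\pi}_N(\omega)}, \] where $Z^{J,\pi}_N$ is the normalizing constant and $C^\pi_N(\omega)$ is the number of clusters (connected components of $\mathbb Z^d$ with the open edges), for the configuration equal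 to $\omega$ on $E_N$ and to $\pi$ outside $E_N$, that contain an endpoint of an edge of $E_N$. Let $\mathbb E\Phi^{J,\pi}_{\hat\Lambda_N}$ be the joint law of $(J,\omega)$ on $[0,1]^{E(\mathbb Z^d)}\times\{0,1\}^{E(\mathbb Z^d)}$, where $J$ is i.i.d. with law $\rho$ and, given $J$, $\omega$ has law $\Phi^{J,\pi}_{\hat\Lambda_N}$. Then for every $\beta\ge 0$ the weak limits $\Theta^f_\infty=\lim_{N\to\infty}\mathbb E\Phi^{J,f}_{\hat\Lambda_N}$ and $\Theta^w_\infty=\lim_{N\to\infty}\mathbb E\Phi^{J,w}_{\hat\Lambda_N}$ (for the product topology) exist, and the set \[ \mathcal D_{\rho,q,d}=\Bigl\{\beta\ge 0:\ \lim_{N\to\infty}\mathbb E\Phi^{J,f}_{\hat\Lambda_N}\ne\lim_{N\to\infty}\mathbb E\Phi^{J,w}_{\hat\Lambda_N}\Bigr\} \] is at most countable. -/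

import Mathlib

open MeasureTheory ProbabilityTheory Filter Topology
open scoped NNReal

noncomputable section

namespace RandomFK

/-- The nearest-neighbour graph of `ℤ^d`: `x ∼ y` iff the Euclidean norm of `x - y` is `1`. -/
def lattice (d : ℕ) : SimpleGraph (Fin d → ℤ) where
  Adj x y := ∑ i, (x i - y i) ^ 2 = 1
  symm := ⟨fun x y h => by
    rw [← h]
    exact Finset.sum_congr rfl fun i _ => by ring⟩
  loopless := ⟨fun x h => by simp at h⟩

/-- The edge set `E(ℤ^d)`: unordered pairs of nearest neighbours. -/
abbrev Edge (d : ℕ) : Type := (lattice d).edgeSet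

instance (d : ℕ) : Countable (Edge d) := by
  have : Countable (Sym2 (Fin d → ℤ)) := Quot.mk_surjective.countable
  exact Subtype.countable

/-- Cluster configurations `ω : E(ℤ^d) → {0, 1}` (`true` is open, `false` is closed). -/
abbrev Config (d : ℕ) : Type := Edge d → Bool

/-- Media configurations `J : E(ℤ^d) → [0, 1]`. -/
abbrev Media (d : ℕ) : Type := Edge d → unitInterval

/-- The graph on `ℤ^d` whose edges are the open edges of `ω`. -/
def openGraph {d : ℕ} (ω : Config d) : SimpleGraph (Fin d → ℤ) :=
  SimpleGraph.fromEdgeSet {s | ∃ e : Edge d, e.1 = s ∧ ω e = true}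

open Classical in
/-- The configuration `ω ∨ π`: equal to `ω` on `E` and to `π` off `E`. -/
def glue {d : ℕ} (E : Finset (Edge d)) (ω π : Config d) : Config d :=
  fun e => if e ∈ E then ω e else π e

/-- The number `C_E^π(ω)` of clusters of `ω ∨ π` that touch `E`, that is, that contain an endpoint
of an edge of `E`. -/
def clusterCount {d : ℕ} (E : Finset (Edge d)) (π ω : Config d) : ℕ :=
  Set.ncard {c : (openGraph (glue E ω π)).ConnectedComponent |
    ∃ e ∈ E, ∃ x ∈ e.1, (openGraph (glue E ω π)).connectedComponentMk x = c}

/-- The weight `∏_{e ∈ E} p(J_e)^{ω_e} (1 - p(J_e))^{1 - ω_e} · q^{C_E^π(ω)}`. -/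
def weight {d : ℕ} (p : unitInterval → ℝ) (q : ℝ) (E : Finset (Edge d)) (π : Config d)
    (J : Media d) (ω : Config d) : ℝ :=
  (∏ e ∈ E, if ω e = true then p (J e) else 1 - p (J e)) * q ^ clusterCount E π ω

open Classical in
/-- The configuration whose set of open edges is `A`; for `A` running through the subsets of `E`
these are exactly the configurations that vanish off `E`, each of them once. -/
def openOn {d : ℕ} (A : Finset (Edge d)) : Config d := fun e => decide (e ∈ A)

/-- The partition function `Z_E^{J, p, q, π}`. -/
def partitionFunction {d : ℕ} (p : unitInterval → ℝ) (q : ℝ) (E : Finset (Edge d))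
    (π : Config d) (J : Media d) : ℝ :=
  ∑ A ∈ E.powerset, weight p q E π J (openOn A)

/-- The quenched FK measure `Φ_E^{J, p, q, π}`, carried by the configurations that vanish off `E`. -/
def quenched {d : ℕ} (p : unitInterval → ℝ) (q : ℝ) (E : Finset (Edge d)) (π : Config d)
    (J : Media d) : Measure (Config d) :=
  ∑ A ∈ E.powerset,
    ENNReal.ofReal (weight p q E π J (openOn A) / partitionFunction p q E π J) •
      Measure.dirac (openOn A)

/-- The interaction `p(J) = 1 - exp(-β J)`. -/
def interaction (β : ℝ≥0) (t : unitInterval) : ℝ := 1 - Real.exp (-((β : ℝ) * (t : ℝ)))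

lemma interaction_nonneg (β : ℝ≥0) (t : unitInterval) : 0 ≤ interaction β t := by
  have h : 0 ≤ (β : ℝ) * (t : ℝ) := mul_nonneg β.2 t.2.1
  have := Real.exp_le_one_iff.mpr (neg_nonpos.mpr h)
  unfold interaction
  linarith

lemma one_sub_interaction_pos (β : ℝ≥0) (t : unitInterval) : 0 < 1 - interaction β t := by
  unfold interaction
  have := Real.exp_pos (-((β : ℝ) * (t : ℝ)))
  linarith

lemma measurable_interaction (β : ℝ≥0) : Measurable (interaction β) := by
  unfold interaction
  fun_prop

lemma weight_nonneg {d : ℕ} (β : ℝ≥0) {q : ℝ} (hq : 1 ≤ q) (E : Finset (Edge d)) (π : Config d)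
    (J : Media d) (ω : Config d) : 0 ≤ weight (interaction β) q E π J ω := by
  refine mul_nonneg (Finset.prod_nonneg fun e _ => ?_) (pow_nonneg (by linarith) _)
  split_ifs
  · exact interaction_nonneg _ _
  · exact (one_sub_interaction_pos _ _).le

lemma partitionFunction_pos {d : ℕ} (β : ℝ≥0) {q : ℝ} (hq : 1 ≤ q) (E : Finset (Edge d))
    (π : Config d) (J : Media d) : 0 < partitionFunction (interaction β) q E π J := by
  refine Finset.sum_pos' (fun A _ => weight_nonneg β hq E π J _) ⟨∅, by simp, ?_⟩
  refine mul_pos (Finset.prod_pos fun e _ => ?_) (pow_pos (by linarith) _)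
  simpa [openOn] using one_sub_interaction_pos β (J e)

lemma measurable_weight {d : ℕ} (β : ℝ≥0) (q : ℝ) (E : Finset (Edge d)) (π ω : Config d) :
    Measurable fun J : Media d => weight (interaction β) q E π J ω := by
  unfold weight
  refine Measurable.mul_const (Finset.measurable_prod _ fun e _ => ?_) _
  have := (measurable_interaction β).comp (measurable_pi_apply (X := fun _ : Edge d => unitInterval) e)
  split_ifs
  · exact this
  · exact this.const_sub 1

lemma measurable_quenched {d : ℕ} (β : ℝ≥0) (q : ℝ) (E : Finset (Edge d)) (π : Config d) :
    Measurable (quenched (interaction β) q E π) := by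
  refine Measure.measurable_of_measurable_coe _ fun s _ => ?_
  simp only [quenched, Measure.coe_finsetSum, Finset.sum_apply, Measure.smul_apply, smul_eq_mul]
  refine Finset.measurable_sum _ fun A _ => Measurable.mul_const (Measurable.ennreal_ofReal ?_) _
  refine (measurable_weight β q E π _).div ?_
  unfold partitionFunction
  exact Finset.measurable_sum _ fun B _ => measurable_weight β q E π _

lemma isProbabilityMeasure_quenched {d : ℕ} (β : ℝ≥0) {q : ℝ} (hq : 1 ≤ q) (E : Finset (Edge d))
    (π : Config d) (J : Media d) : IsProbabilityMeasure (quenched (interaction β) q E π J) := by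
  have hZ := partitionFunction_pos β hq E π J
  refine ⟨?_⟩
  simp only [quenched, Measure.coe_finsetSum, Finset.sum_apply, Measure.smul_apply, smul_eq_mul,
    measure_univ, mul_one]
  rw [← ENNReal.ofReal_sum_of_nonneg
    (fun A _ => div_nonneg (weight_nonneg β hq E π J _) hZ.le), ← Finset.sum_div]
  change ENNReal.ofReal (partitionFunction (interaction β) q E π J / _) = 1
  rw [div_self hZ.ne', ENNReal.ofReal_one]

/-- The quenched FK measure as a Markov kernel from media to cluster configurations. -/
def quenchedKernel {d : ℕ} (β : ℝ≥0) (q : ℝ) (E : Finset (Edge d)) (π : Config d) :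
    Kernel (Media d) (Config d) where
  toFun := quenched (interaction β) q E π
  measurable' := measurable_quenched β q E π

lemma isMarkovKernel_quenchedKernel {d : ℕ} (β : ℝ≥0) {q : ℝ} (hq : 1 ≤ q) (E : Finset (Edge d))
    (π : Config d) : IsMarkovKernel (quenchedKernel β q E π) :=
  ⟨isProbabilityMeasure_quenched β hq E π⟩

/-- The law of the media: the `J_e` are independent with common law `ρ`. -/
def mediaLaw (d : ℕ) (ρ : Measure unitInterval) [IsProbabilityMeasure ρ] : Measure (Media d) :=
  Measure.infinitePi fun _ : Edge d => ρ

instance (d : ℕ) (ρ : Measure unitInterval) [IsProbabilityMeasure ρ] :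
    IsProbabilityMeasure (mediaLaw d ρ) := by
  unfold mediaLaw
  infer_instance

/-- The joint law `𝔼 Φ_E^{J, π}` of `(J, ω)`: `J` has the law of the media and, given `J`, `ω` has
the law `Φ_E^{J, π}`. -/
def jointFK {d : ℕ} (ρ : Measure unitInterval) [IsProbabilityMeasure ρ] {q : ℝ} (hq : 1 ≤ q)
    (β : ℝ≥0) (E : Finset (Edge d)) (π : Config d) : ProbabilityMeasure (Media d × Config d) :=
  ⟨(mediaLaw d ρ) ⊗ₘ (quenchedKernel β q E π), by
    have := isMarkovKernel_quenchedKernel β hq E π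
    infer_instance⟩

/-- The symmetric box `{-N, …, N}^d`. -/
def symBox (d N : ℕ) : Finset (Fin d → ℤ) :=
  Finset.Icc (fun _ => -(N : ℤ)) (fun _ => (N : ℤ))

lemma finite_edges_touching {d : ℕ} (Λ : Finset (Fin d → ℤ)) :
    {e : Edge d | ∃ x ∈ Λ, x ∈ e.1}.Finite := by
  classical
  refine Set.Finite.of_finite_image (f := Subtype.val) (Set.Finite.subset
    (Λ.biUnion fun x => (Finset.Icc (x - 1) (x + 1)).image fun y => s(x, y)).finite_toSet ?_)
    Subtype.val_injective.injOn
  rintro _ ⟨⟨e, he⟩, ⟨x, hx, hxe⟩, rfl⟩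
  obtain ⟨y, rfl⟩ := Sym2.mem_iff_exists.mp hxe
  have hadj : ∑ i, (x i - y i) ^ 2 = 1 := he
  have key : ∀ i, (x i - y i) ^ 2 ≤ 1 := fun i => by
    rw [← hadj]
    exact Finset.single_le_sum (f := fun i => (x i - y i) ^ 2) (fun i _ => sq_nonneg _)
      (Finset.mem_univ i)
  simp only [Finset.coe_biUnion, Set.mem_iUnion, Finset.coe_image]
  refine ⟨x, hx, y, ?_, rfl⟩
  rw [Finset.mem_coe, Finset.mem_Icc]
  constructor <;> intro i <;> have := key i <;> simp only [Pi.sub_apply, Pi.add_apply,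
    Pi.one_apply] <;> nlinarith

/-- The set `E^w(Λ)` of the edges that touch `Λ`. -/
def edgesTouching {d : ℕ} (Λ : Finset (Fin d → ℤ)) : Finset (Edge d) :=
  (finite_edges_touching Λ).toFinset

/-- The free boundary condition. -/
def free (d : ℕ) : Config d := fun _ => false

/-- The wired boundary condition. -/
def wired (d : ℕ) : Config d := fun _ => true

/-- `Θ` is the infinite-volume measure with boundary condition `π`: the weak limit, as `N → ∞`, of
the joint laws `𝔼 Φ^{J, π}` in the boxes `{-N, …, N}^d`, for the product topology of
`[0, 1]^{E(ℤ^d)} × {0, 1}^{E(ℤ^d)}`. -/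
def IsInfiniteVolumeLimit {d : ℕ} (ρ : Measure unitInterval) [IsProbabilityMeasure ρ] {q : ℝ}
    (hq : 1 ≤ q) (β : ℝ≥0) (π : Config d) (Θ : ProbabilityMeasure (Media d × Config d)) : Prop :=
  Tendsto (fun N : ℕ => jointFK ρ hq β (edgesTouching (symBox d N)) π) atTop (𝓝 Θ)

end RandomFK

end

/-!
The argument compares free and wired boundary conditions, first in finite volume and for fixed media
`J`, then on average over `J`.

*Existence of the limits.* Opening an edge inside the domain loses one cluster exactly when its
endpoints were not yet connected, so the cluster count is supermodular in the open set
(`clusters_add_le`) and, as `q ≥ 1`, the four functions theorem compares any two random cluster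
measures whose boundary conditions are ordered (`mean_le_mean`). An edge outside the domain counts
as frozen at its boundary value, so one statement covers monotonicity in the domain, in the boundary
condition and in `β`. Hence for every `J` the probability that all edges of a finite set are open
increases with the domain for free, and decreases for wired, boundary conditions; call the limits
`freeProb` and `wiredProb`. The functions `allOpen A` span a dense subspace of the continuous
functions of `ω`, so dominated convergence in `J` and compactness of the space of probability
measures give the weak limits (`exists_isInfiniteVolumeLimit`).

*Equality of the limits.* As `∑_{e ∈ A} ω_e - ∏_{e ∈ A} ω_e` is increasing, the two limits agree as
soon as `freeProb` and `wiredProb` agree on single edges for almost all `J`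
(`wiredProb_sub_freeProb_le`, `eq_of_isInfiniteVolumeLimit`).

*Countability.* For `0 < β ≤ β'` the weights satisfy `w_{β'} = w_β · exp L`, where `L` is, up to a
term that does not depend on `ω`, the sum over the open edges of
`ℓ_e = log ((e^{β' J_e} - 1) / (e^{β J_e} - 1))`. Jensen's inequality, applied with `w_β` for the
wired and with `w_{β'}` for the free boundary condition, bounds the logarithm of the ratio of the
partition functions from below and from above by the mean of `L`. Free and wired partition functions
differ by at most a factor `q` for each vertex of the outer boundary, so
`∑_e ℓ_e wiredProb_β e ≤ ∑_e ℓ_e freeProb_{β'} e` over a box, up to a surface term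
(`sum_logOddsRatio_mul_wiredProb_le`). Translation invariance of the averaged probabilities removes
the surface term for the edges at the origin. Since
`(β' - β) J_e ≤ ℓ_e ≤ (β' - β) e^{β'} / β`, letting `β` increase to `β'` bounds the mean of
`J_e (wiredProb - freeProb)` at `β'` by the jump of the wired edge density there. That density is a
monotone function of `β`, so the jump vanishes for all but countably many `β'`
(`ae_wiredProb_eq_freeProb`); where `J_e = 0` the edge is closed in either case.
-/

noncomputable section

namespace RandomFK

section


/-! ### Counting the components that meet a set -/

section Graph

variable {α : Type*}

/-- The number of connected components of `G` that contain a vertex of `V`. -/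
def touchCount (V : Set α) (G : SimpleGraph α) : ℕ := (G.connectedComponentMk '' V).ncard

lemma reachable_of_reachable_sup_edge {G : SimpleGraph α} {x y u v : α}
    (h : (G ⊔ SimpleGraph.edge x y).Reachable u v) :
    G.Reachable u v ∨ (G.Reachable u x ∧ G.Reachable y v) ∨
      (G.Reachable u y ∧ G.Reachable x v) := by
  obtain ⟨w⟩ := h
  induction w with
  | nil => exact Or.inl (.refl _)
  | @cons a b c hadj w ih =>
    rw [SimpleGraph.sup_adj, SimpleGraph.edge_adj] at hadj
    rcases hadj with hadj | ⟨⟨rfl, rfl⟩ | ⟨rfl, rfl⟩, _⟩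
    · have hab : G.Reachable a b := hadj.reachable
      rcases ih with h | ⟨h1, h2⟩ | ⟨h1, h2⟩
      · exact Or.inl (hab.trans h)
      · exact Or.inr (Or.inl ⟨hab.trans h1, h2⟩)
      · exact Or.inr (Or.inr ⟨hab.trans h1, h2⟩)
    · rcases ih with h | ⟨h1, h2⟩ | ⟨h1, h2⟩
      · exact Or.inr (Or.inl ⟨.refl _, h⟩)
      · exact Or.inr (Or.inl ⟨.refl _, h2⟩)
      · exact Or.inl h2
    · rcases ih with h | ⟨h1, h2⟩ | ⟨h1, h2⟩
      · exact Or.inr (Or.inr ⟨.refl _, h⟩)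
      · exact Or.inl h2
      · exact Or.inr (Or.inr ⟨.refl _, h2⟩)

lemma touchCount_le_ncard {V : Set α} (hV : V.Finite) (G : SimpleGraph α) :
    touchCount V G ≤ V.ncard :=
  Set.ncard_image_le hV

lemma touchCount_anti {V : Set α} (hV : V.Finite) {G H : SimpleGraph α} (h : G ≤ H) :
    touchCount V H ≤ touchCount V G := by
  have : H.connectedComponentMk '' V =
      SimpleGraph.ConnectedComponent.map (.ofLE h) '' (G.connectedComponentMk '' V) := by
    rw [Set.image_image]
    rfl
  unfold touchCount
  rw [this]
  exact Set.ncard_image_le (hV.image _)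

lemma touchCount_sup_edge_of_reachable {V : Set α} {G : SimpleGraph α} {x y : α}
    (h : G.Reachable x y) : touchCount V (G ⊔ SimpleGraph.edge x y) = touchCount V G := by
  have : (G ⊔ SimpleGraph.edge x y).connectedComponentMk '' V =
      SimpleGraph.ConnectedComponent.map (.ofLE le_sup_left) '' (G.connectedComponentMk '' V) := by
    rw [Set.image_image]
    rfl
  unfold touchCount
  rw [this]
  refine Set.InjOn.ncard_image ?_
  rintro _ ⟨u, -, rfl⟩ _ ⟨v, -, rfl⟩ huv
  have huv' : (G ⊔ SimpleGraph.edge x y).Reachable u v :=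
    SimpleGraph.ConnectedComponent.exact huv
  refine SimpleGraph.ConnectedComponent.sound ?_
  rcases reachable_of_reachable_sup_edge huv' with h' | ⟨h1, h2⟩ | ⟨h1, h2⟩
  · exact h'
  · exact h1.trans (h.trans h2)
  · exact h1.trans (h.symm.trans h2)

lemma touchCount_sup_edge_of_not_reachable {V : Set α} (hV : V.Finite) {G : SimpleGraph α}
    {x y : α} (hx : x ∈ V) (hy : y ∈ V) (h : ¬ G.Reachable x y) :
    touchCount V (G ⊔ SimpleGraph.edge x y) + 1 = touchCount V G := by
  have hne : x ≠ y := fun h' => h (h' ▸ .refl _)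
  have hle : G ≤ G ⊔ SimpleGraph.edge x y := le_sup_left
  -- The two components of `x` and `y` merge, all other ones are kept apart.
  have himg : (G ⊔ SimpleGraph.edge x y).connectedComponentMk '' V =
      SimpleGraph.ConnectedComponent.map (.ofLE hle) ''
        ((G.connectedComponentMk '' V) \ {G.connectedComponentMk y}) := by
    ext c
    constructor
    · rintro ⟨v, hv, rfl⟩
      by_cases hvy : G.connectedComponentMk v = G.connectedComponentMk y
      · refine ⟨G.connectedComponentMk x, ⟨⟨x, hx, rfl⟩, fun h' =>
          h (SimpleGraph.ConnectedComponent.exact h')⟩, ?_⟩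
        refine SimpleGraph.ConnectedComponent.sound ?_
        have h1 : (G ⊔ SimpleGraph.edge x y).Adj x y := by
          rw [SimpleGraph.sup_adj, SimpleGraph.edge_adj]
          exact Or.inr ⟨Or.inl ⟨rfl, rfl⟩, hne⟩
        exact h1.reachable.trans
          ((SimpleGraph.ConnectedComponent.exact hvy).symm.mono hle)
      · exact ⟨_, ⟨⟨v, hv, rfl⟩, hvy⟩, rfl⟩
    · rintro ⟨_, ⟨⟨v, hv, rfl⟩, -⟩, rfl⟩
      exact ⟨v, hv, rfl⟩
  unfold touchCount
  rw [himg, Set.InjOn.ncard_image ?_, Set.ncard_sdiff_singleton_add_one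
    (Set.mem_image_of_mem _ hy) (hV.image _)]
  rintro _ ⟨⟨u, -, rfl⟩, hu⟩ _ ⟨⟨v, -, rfl⟩, hv⟩ huv
  have huv' : (G ⊔ SimpleGraph.edge x y).Reachable u v :=
    SimpleGraph.ConnectedComponent.exact huv
  refine SimpleGraph.ConnectedComponent.sound ?_
  rcases reachable_of_reachable_sup_edge huv' with h' | ⟨h1, h2⟩ | ⟨h1, h2⟩
  · exact h'
  · exact absurd (SimpleGraph.ConnectedComponent.sound h2.symm) hv
  · exact absurd (SimpleGraph.ConnectedComponent.sound h1) hu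

end Graph

variable {d : ℕ}

/-- The endpoints of the edges of `E`. -/
def endpoints (E : Finset (Edge d)) : Set (Fin d → ℤ) := {x | ∃ e ∈ E, x ∈ e.1}

lemma finite_setOf_mem_edge (e : Edge d) : {x | x ∈ e.1}.Finite := by
  obtain ⟨e, he⟩ := e
  induction e with
  | _ x y =>
    refine (Set.toFinite {x, y}).subset fun z hz => ?_
    simpa using hz

lemma finite_endpoints (E : Finset (Edge d)) : (endpoints E).Finite := by
  have : endpoints E = ⋃ e ∈ E, {x | x ∈ e.1} := by
    ext x
    simp [endpoints]
  rw [this]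
  exact E.finite_toSet.biUnion fun e _ => finite_setOf_mem_edge e

/-- The number of clusters of `ω` that touch `E`. -/
def clusters (E : Finset (Edge d)) (ω : Config d) : ℕ := touchCount (endpoints E) (openGraph ω)

lemma clusterCount_eq (E : Finset (Edge d)) (π ω : Config d) :
    clusterCount E π ω = clusters E (glue E ω π) := by
  unfold clusterCount clusters touchCount
  congr 1
  ext c
  simp only [endpoints, Set.mem_ofPred_eq, Set.mem_image]
  constructor
  · rintro ⟨e, he, x, hx, h⟩
    exact ⟨x, ⟨e, he, hx⟩, h⟩
  · rintro ⟨x, ⟨e, he, hx⟩, h⟩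
    exact ⟨e, he, x, hx, h⟩

lemma openGraph_mono {ω ω' : Config d} (h : ω ≤ ω') : openGraph ω ≤ openGraph ω' := by
  refine SimpleGraph.fromEdgeSet_mono ?_
  rintro s ⟨e, he, ho⟩
  exact ⟨e, he, Bool.eq_true_of_true_le (ho ▸ h e)⟩

lemma clusters_anti (E : Finset (Edge d)) {ω ω' : Config d} (h : ω ≤ ω') :
    clusters E ω' ≤ clusters E ω :=
  touchCount_anti (finite_endpoints E) (openGraph_mono h)

open Classical in
lemma openGraph_update (ω : Config d) (e : Edge d) {x y : Fin d → ℤ} (hxy : e.1 = s(x, y)) :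
    openGraph (Function.update ω e true) = openGraph ω ⊔ SimpleGraph.edge x y := by
  unfold openGraph
  rw [SimpleGraph.edge, ← SimpleGraph.fromEdgeSet_union]
  congr 1
  ext s
  simp only [Set.mem_ofPred_eq, Set.mem_union, Set.mem_singleton_iff]
  constructor
  · rintro ⟨e', rfl, ho⟩
    by_cases h : e' = e
    · subst h
      exact Or.inr hxy
    · rw [Function.update_of_ne h] at ho
      exact Or.inl ⟨e', rfl, ho⟩
  · rintro (⟨e', rfl, ho⟩ | rfl)
    · refine ⟨e', rfl, ?_⟩
      by_cases h : e' = e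
      · subst h; simp
      · rwa [Function.update_of_ne h]
    · exact ⟨e, hxy, by simp⟩

open Classical in
/-- Opening an edge that lies in `E₁ ∩ E₂` loses at most as many clusters in the larger of two
configurations as in the smaller one. -/
lemma clusters_update_add_le {E₁ E₂ : Finset (Edge d)} {a b : Config d} (hab : a ≤ b) {e : Edge d}
    (h₁ : e ∈ E₁) (h₂ : e ∈ E₂) :
    clusters E₁ (Function.update a e true) + clusters E₂ b ≤
      clusters E₁ a + clusters E₂ (Function.update b e true) := by
  obtain ⟨x, y, hxy⟩ : ∃ x y, e.1 = s(x, y) := by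
    induction h : e.1 with
    | _ x y => exact ⟨x, y, rfl⟩
  have hx : x ∈ e.1 := by rw [hxy]; simp
  have hy : y ∈ e.1 := by rw [hxy]; simp
  unfold clusters
  rw [openGraph_update a e hxy, openGraph_update b e hxy]
  by_cases h : (openGraph b).Reachable x y
  · rw [touchCount_sup_edge_of_reachable h]
    exact Nat.add_le_add_right (touchCount_anti (finite_endpoints _) le_sup_left) _
  · have ha : ¬ (openGraph a).Reachable x y := fun h' => h (h'.mono (openGraph_mono hab))
    have e1 := touchCount_sup_edge_of_not_reachable (finite_endpoints E₁) ⟨e, h₁, hx⟩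
      ⟨e, h₁, hy⟩ ha
    have e2 := touchCount_sup_edge_of_not_reachable (finite_endpoints E₂) ⟨e, h₂, hx⟩
      ⟨e, h₂, hy⟩ h
    omega

open Classical in
lemma clusters_sup_openOn_add_le {E₁ E₂ : Finset (Edge d)} {a b : Config d} (hab : a ≤ b)
    (D : Finset (Edge d)) (h₁ : D ⊆ E₁) (h₂ : D ⊆ E₂) :
    clusters E₁ (a ⊔ openOn D) + clusters E₂ b ≤ clusters E₁ a + clusters E₂ (b ⊔ openOn D) := by
  induction D using Finset.induction_on with
  | empty =>
    have h (c : Config d) : c ⊔ openOn ∅ = c := by ext e; simp [openOn]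
    rw [h, h]
  | insert e D he ih =>
    have h (c : Config d) :
        c ⊔ openOn (insert e D) = Function.update (c ⊔ openOn D) e true := by
      funext e'
      by_cases h' : e' = e
      · subst h'; simp [openOn]
      · simp [openOn, h']
    have ih' := ih (fun x hx => h₁ (Finset.mem_insert_of_mem hx))
      (fun x hx => h₂ (Finset.mem_insert_of_mem hx))
    have := clusters_update_add_le (sup_le_sup_right hab (openOn D))
      (h₁ (Finset.mem_insert_self e D)) (h₂ (Finset.mem_insert_self e D))
    rw [h, h]
    omega

end

section


/-! ### Stochastic comparison of random cluster measures -/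

variable {d : ℕ}

open scoped FinsetFamily

open Classical in
/-- The finite set of the configurations that agree with `π` off `E`. -/
def agreeing (E : Finset (Edge d)) (π : Config d) : Finset (Config d) :=
  E.powerset.image fun A => glue E (openOn A) π

lemma mem_agreeing {E : Finset (Edge d)} {π ω : Config d} :
    ω ∈ agreeing E π ↔ ∀ e ∉ E, ω e = π e := by
  classical
  simp only [agreeing, Finset.mem_image, Finset.mem_powerset]
  constructor
  · rintro ⟨A, -, rfl⟩ e he
    simp [glue, he]
  · intro h
    refine ⟨E.filter fun e => ω e = true, Finset.filter_subset _ _, ?_⟩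
    funext e
    by_cases he : e ∈ E
    · simp [glue, openOn, he]
    · simp [glue, he, h e he]

lemma glue_openOn_injOn (E : Finset (Edge d)) (π : Config d) :
    Set.InjOn (fun A => glue E (openOn A) π) (E.powerset : Set (Finset (Edge d))) := by
  intro A hA B hB h
  simp only [Finset.coe_powerset, Set.mem_preimage, Set.mem_powerset_iff, Finset.coe_subset]
    at hA hB
  ext e
  have he := congrFun h e
  by_cases heE : e ∈ E
  · simpa [glue, heE, openOn] using he
  · exact ⟨fun h' => absurd (hA h') heE, fun h' => absurd (hB h') heE⟩

/-- The weight of a configuration that already carries its boundary condition off `E`. -/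
def boltzmann (p : unitInterval → ℝ) (q : ℝ) (E : Finset (Edge d)) (J : Media d)
    (ω : Config d) : ℝ :=
  (∏ e ∈ E, if ω e = true then p (J e) else 1 - p (J e)) * q ^ clusters E ω

lemma weight_eq_boltzmann (p : unitInterval → ℝ) (q : ℝ) (E : Finset (Edge d)) (π : Config d)
    (J : Media d) (ω : Config d) :
    weight p q E π J ω = boltzmann p q E J (glue E ω π) := by
  unfold weight boltzmann
  rw [clusterCount_eq]
  congr 1
  refine Finset.prod_congr rfl fun e he => ?_
  simp [glue, he]

lemma boltzmann_nonneg (β : ℝ≥0) {q : ℝ} (hq : 1 ≤ q) (E : Finset (Edge d)) (J : Media d)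
    (ω : Config d) : 0 ≤ boltzmann (interaction β) q E J ω := by
  refine mul_nonneg (Finset.prod_nonneg fun e _ => ?_) (pow_nonneg (by linarith) _)
  split_ifs
  · exact interaction_nonneg _ _
  · exact (one_sub_interaction_pos _ _).le

lemma sum_weight_mul (p : unitInterval → ℝ) (q : ℝ) (E : Finset (Edge d)) (π : Config d)
    (J : Media d) (f : Config d → ℝ) :
    ∑ A ∈ E.powerset, weight p q E π J (openOn A) * f (glue E (openOn A) π) =
      ∑ ω ∈ agreeing E π, boltzmann p q E J ω * f ω := by
  classical
  rw [agreeing, Finset.sum_image (glue_openOn_injOn E π)]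
  exact Finset.sum_congr rfl fun A _ => by rw [weight_eq_boltzmann]

lemma partitionFunction_eq (p : unitInterval → ℝ) (q : ℝ) (E : Finset (Edge d)) (π : Config d)
    (J : Media d) :
    partitionFunction p q E π J = ∑ ω ∈ agreeing E π, boltzmann p q E J ω := by
  simpa [partitionFunction] using sum_weight_mul p q E π J 1

/-- The expectation of `f (ω ∨ π)` under the quenched measure `Φ_E^{J, π}`. The observable sees the
boundary condition off `E`, which makes the monotonicity in `E` hold for all increasing `f`. -/
def mean (β : ℝ≥0) (q : ℝ) (E : Finset (Edge d)) (π : Config d) (J : Media d)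
    (f : Config d → ℝ) : ℝ :=
  (∑ A ∈ E.powerset, weight (interaction β) q E π J (openOn A) * f (glue E (openOn A) π)) /
    partitionFunction (interaction β) q E π J

lemma mean_eq (β : ℝ≥0) (q : ℝ) (E : Finset (Edge d)) (π : Config d) (J : Media d)
    (f : Config d → ℝ) : mean β q E π J f =
      (∑ ω ∈ agreeing E π, boltzmann (interaction β) q E J ω * f ω) /
        ∑ ω ∈ agreeing E π, boltzmann (interaction β) q E J ω := by
  rw [mean, sum_weight_mul, partitionFunction_eq]

lemma interaction_mono {β₁ β₂ : ℝ≥0} (h : β₁ ≤ β₂) (t : unitInterval) :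
    interaction β₁ t ≤ interaction β₂ t := by
  unfold interaction
  have : (β₁ : ℝ) * t ≤ β₂ * t := mul_le_mul_of_nonneg_right (by exact_mod_cast h) t.2.1
  have := Real.exp_le_exp.mpr (neg_le_neg this)
  linarith

/-- The lattice condition for the product part of the weights. The products over `E₁` and `E₂` are
extended to `E₁ ∪ E₂` by factors one, and then compared edge by edge. -/
lemma prod_edge_mul_le {p₁ p₂ : unitInterval → ℝ} (h₁ : ∀ t, 0 ≤ p₁ t) (h₁' : ∀ t, p₁ t ≤ 1)
    (h₂ : ∀ t, 0 ≤ p₂ t) (h₂' : ∀ t, p₂ t ≤ 1)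
    (h : ∀ t, p₁ t ≤ p₂ t) {E₁ E₂ : Finset (Edge d)} {a b : Config d}
    (ha : ∀ e ∉ E₁, e ∈ E₂ → a e = false) (hb : ∀ e ∉ E₂, e ∈ E₁ → b e = true) (J : Media d) :
    (∏ e ∈ E₁, if a e = true then p₁ (J e) else 1 - p₁ (J e)) *
        (∏ e ∈ E₂, if b e = true then p₂ (J e) else 1 - p₂ (J e)) ≤
      (∏ e ∈ E₁, if (a ⊓ b) e = true then p₁ (J e) else 1 - p₁ (J e)) *
        (∏ e ∈ E₂, if (a ⊔ b) e = true then p₂ (J e) else 1 - p₂ (J e)) := by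
  classical
  have key (E E' : Finset (Edge d)) (f : Edge d → ℝ) :
      ∏ e ∈ E, f e = ∏ e ∈ E ∪ E', if e ∈ E then f e else 1 := by
    rw [Finset.prod_ite, Finset.prod_const_one, mul_one, Finset.filter_mem_eq_inter,
      Finset.inter_eq_right.mpr Finset.subset_union_left]
  have key' (E E' : Finset (Edge d)) (f : Edge d → ℝ) :
      ∏ e ∈ E, f e = ∏ e ∈ E' ∪ E, if e ∈ E then f e else 1 := by
    rw [Finset.union_comm, ← key]
  rw [key E₁ E₂, key' E₂ E₁, key E₁ E₂, key' E₂ E₁, ← Finset.prod_mul_distrib,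
    ← Finset.prod_mul_distrib]
  refine Finset.prod_le_prod (fun e _ => ?_) fun e _ => ?_
  · refine mul_nonneg ?_ ?_
    · split_ifs <;> linarith [h₁ (J e), h₁' (J e)]
    · split_ifs <;> linarith [h₂ (J e), h₂' (J e)]
  · by_cases he1 : e ∈ E₁ <;> by_cases he2 : e ∈ E₂
    · simp only [he1, he2, if_true, Pi.inf_apply, Pi.sup_apply]
      rcases Bool.eq_false_or_eq_true (a e) with ha' | ha' <;>
        rcases Bool.eq_false_or_eq_true (b e) with hb' | hb' <;> simp only [ha', hb'] <;> simp
      nlinarith [h (J e)]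
    · simp [he1, he2, hb e he2 he1]
    · simp [he1, he2, ha e he1 he2]
    · simp [he1, he2]

/-- Supermodularity of the cluster count, for two domains and two boundary conditions at once. -/
lemma clusters_add_le {E₁ E₂ : Finset (Edge d)} {a b : Config d}
    (h : ∀ e, a e = true → b e = false → e ∈ E₁ ∧ e ∈ E₂) :
    clusters E₁ a + clusters E₂ b ≤ clusters E₁ (a ⊓ b) + clusters E₂ (a ⊔ b) := by
  classical
  have := clusters_sup_openOn_add_le (E₁ := E₁) (E₂ := E₂) (inf_le_right : a ⊓ b ≤ b)
    (E₁.filter fun e => a e = true ∧ b e = false) (Finset.filter_subset _ _)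
    (fun e he => (h e (Finset.mem_filter.mp he).2.1 (Finset.mem_filter.mp he).2.2).2)
  have e1 : a ⊓ b ⊔ openOn (E₁.filter fun e => a e = true ∧ b e = false) = a := by
    funext e
    by_cases ha : a e = true <;> by_cases hb : b e = true <;> simp_all [openOn]
  have e2 : b ⊔ openOn (E₁.filter fun e => a e = true ∧ b e = false) = a ⊔ b := by
    funext e
    by_cases ha : a e = true <;> by_cases hb : b e = true <;> simp_all [openOn]
  rwa [e1, e2] at this

/-- **Comparison inequality.** The random cluster measure increases stochastically with `β` and
with the boundary condition; an edge outside the domain counts as an edge frozen by the boundary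
condition. -/
theorem mean_le_mean {q : ℝ} (hq : 1 ≤ q) {β₁ β₂ : ℝ≥0} (hβ : β₁ ≤ β₂)
    {E₁ E₂ : Finset (Edge d)} {π₁ π₂ : Config d} (hπ : π₁ ≤ π₂)
    (h₁ : ∀ e ∉ E₁, e ∈ E₂ → π₁ e = false) (h₂ : ∀ e ∉ E₂, e ∈ E₁ → π₂ e = true)
    (J : Media d) {f : Config d → ℝ} (hf : Monotone f) (hf0 : 0 ≤ f) :
    mean β₁ q E₁ π₁ J f ≤ mean β₂ q E₂ π₂ J f := by
  classical
  have hq0 : 0 < q := by linarith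
  set B₁ := boltzmann (interaction β₁) q E₁ J with hB₁
  set B₂ := boltzmann (interaction β₂) q E₂ J with hB₂
  have nn1 : ∀ ω, 0 ≤ B₁ ω := fun ω => boltzmann_nonneg β₁ hq E₁ J ω
  have nn2 : ∀ ω, 0 ≤ B₂ ω := fun ω => boltzmann_nonneg β₂ hq E₂ J ω
  have diff : ∀ a ∈ agreeing E₁ π₁, ∀ b ∈ agreeing E₂ π₂, ∀ e, a e = true → b e = false →
      e ∈ E₁ ∧ e ∈ E₂ := by
    intro a ha b hb e hae hbe
    rw [mem_agreeing] at ha hb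
    by_cases he1 : e ∈ E₁ <;> by_cases he2 : e ∈ E₂
    · exact ⟨he1, he2⟩
    · rw [hb e he2, h₂ e he2 he1] at hbe
      exact absurd hbe (by simp)
    · rw [ha e he1, h₁ e he1 he2] at hae
      exact absurd hae (by simp)
    · have := hπ e
      rw [← ha e he1, ← hb e he2, hae, hbe] at this
      exact absurd (Bool.eq_true_of_true_le this) (by simp)
  have inf_mem : ∀ a ∈ agreeing E₁ π₁, ∀ b ∈ agreeing E₂ π₂, a ⊓ b ∈ agreeing E₁ π₁ := by
    intro a ha b hb
    rw [mem_agreeing]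
    intro e he
    rw [← mem_agreeing.mp ha e he]
    have := diff a ha b hb e
    by_cases hae : a e = true <;> by_cases hbe : b e = true <;> simp_all
  have sup_mem : ∀ a ∈ agreeing E₁ π₁, ∀ b ∈ agreeing E₂ π₂, a ⊔ b ∈ agreeing E₂ π₂ := by
    intro a ha b hb
    rw [mem_agreeing]
    intro e he
    rw [← mem_agreeing.mp hb e he]
    have := diff a ha b hb e
    by_cases hae : a e = true <;> by_cases hbe : b e = true <;> simp_all
  have main : ∀ a ∈ agreeing E₁ π₁, ∀ b ∈ agreeing E₂ π₂,
      B₁ a * B₂ b ≤ B₁ (a ⊓ b) * B₂ (a ⊔ b) := by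
    intro a ha b hb
    have hp1 : ∀ t, interaction β₁ t ≤ 1 := fun t => by
      linarith [one_sub_interaction_pos β₁ t]
    have hp2 : ∀ t, interaction β₂ t ≤ 1 := fun t => by
      linarith [one_sub_interaction_pos β₂ t]
    have hprod := prod_edge_mul_le (interaction_nonneg β₁) hp1 (interaction_nonneg β₂) hp2
      (interaction_mono hβ)
      (fun e he1 he2 => (mem_agreeing.mp ha e he1).trans (h₁ e he1 he2))
      (fun e he2 he1 => (mem_agreeing.mp hb e he2).trans (h₂ e he2 he1)) J
    have hcl := pow_le_pow_right₀ hq (clusters_add_le (diff a ha b hb))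
    rw [pow_add, pow_add] at hcl
    have nn (β : ℝ≥0) (E : Finset (Edge d)) (ω : Config d) : 0 ≤ ∏ e ∈ E,
        if ω e = true then interaction β (J e) else 1 - interaction β (J e) :=
      Finset.prod_nonneg fun e _ => by
        split_ifs
        · exact interaction_nonneg _ _
        · exact (one_sub_interaction_pos _ _).le
    have := mul_le_mul hprod hcl (by positivity) (mul_nonneg (nn _ _ _) (nn _ _ _))
    simp only [hB₁, hB₂, boltzmann]
    calc _ = _ := by ring
      _ ≤ _ := this
      _ = _ := by ring
  have four := four_functions_theorem
    (fun ω => if ω ∈ agreeing E₁ π₁ then B₁ ω * f ω else 0)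
    (fun ω => if ω ∈ agreeing E₂ π₂ then B₂ ω else 0)
    (fun ω => if ω ∈ agreeing E₁ π₁ then B₁ ω else 0)
    (fun ω => if ω ∈ agreeing E₂ π₂ then B₂ ω * f ω else 0)
    (fun ω => by dsimp; split_ifs; exacts [mul_nonneg (nn1 ω) (hf0 ω), le_rfl])
    (fun ω => by dsimp; split_ifs; exacts [nn2 ω, le_rfl])
    (fun ω => by dsimp; split_ifs; exacts [nn1 ω, le_rfl])
    (fun ω => by dsimp; split_ifs; exacts [mul_nonneg (nn2 ω) (hf0 ω), le_rfl])
    (by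
      intro a b
      by_cases ha : a ∈ agreeing E₁ π₁
      · by_cases hb : b ∈ agreeing E₂ π₂
        · simp only [ha, hb, inf_mem a ha b hb, sup_mem a ha b hb, if_true]
          have hfab : f a ≤ f (a ⊔ b) := hf le_sup_left
          calc B₁ a * f a * B₂ b = B₁ a * B₂ b * f a := by ring
            _ ≤ B₁ (a ⊓ b) * B₂ (a ⊔ b) * f (a ⊔ b) :=
              mul_le_mul (main a ha b hb) hfab (hf0 a) (mul_nonneg (nn1 _) (nn2 _))
            _ = _ := by ring
        · simp only [hb, if_false, mul_zero]
          refine mul_nonneg ?_ ?_ <;> split_ifs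
          exacts [nn1 _, le_rfl, mul_nonneg (nn2 _) (hf0 _), le_rfl]
      · simp only [ha, if_false, zero_mul]
        refine mul_nonneg ?_ ?_ <;> split_ifs
        exacts [nn1 _, le_rfl, mul_nonneg (nn2 _) (hf0 _), le_rfl])
    (agreeing E₁ π₁) (agreeing E₂ π₂)
  have sub1 : agreeing E₁ π₁ ⊼ agreeing E₂ π₂ ⊆ agreeing E₁ π₁ :=
    Finset.infs_subset_iff.mpr inf_mem
  have sub2 : agreeing E₁ π₁ ⊻ agreeing E₂ π₂ ⊆ agreeing E₂ π₂ :=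
    Finset.sups_subset_iff.mpr sup_mem
  have hsum (S : Finset (Config d)) (g : Config d → ℝ) :
      ∑ ω ∈ S, (if ω ∈ S then g ω else 0) = ∑ ω ∈ S, g ω :=
    Finset.sum_congr rfl fun ω hω => if_pos hω
  have hsum' (S T : Finset (Config d)) (hT : T ⊆ S) (g : Config d → ℝ) (hg : ∀ ω, 0 ≤ g ω) :
      ∑ ω ∈ T, (if ω ∈ S then g ω else 0) ≤ ∑ ω ∈ S, g ω := by
    rw [← hsum S g]
    exact Finset.sum_le_sum_of_subset_of_nonneg hT fun ω hω _ => by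
      simpa [hω] using hg ω
  rw [hsum, hsum] at four
  have hfin := four.trans (mul_le_mul (hsum' _ _ sub1 _ nn1)
    (hsum' _ _ sub2 _ fun ω => mul_nonneg (nn2 ω) (hf0 ω))
    (Finset.sum_nonneg fun ω _ => by split_ifs; exacts [mul_nonneg (nn2 ω) (hf0 ω), le_rfl])
    (Finset.sum_nonneg fun ω _ => nn1 ω))
  have Z1 : 0 < ∑ ω ∈ agreeing E₁ π₁, B₁ ω := by
    rw [hB₁, ← partitionFunction_eq]; exact partitionFunction_pos β₁ hq E₁ π₁ J
  have Z2 : 0 < ∑ ω ∈ agreeing E₂ π₂, B₂ ω := by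
    rw [hB₂, ← partitionFunction_eq]; exact partitionFunction_pos β₂ hq E₂ π₂ J
  rw [mean_eq, mean_eq, div_le_div_iff₀ Z1 Z2]
  linarith

end

section


/-! ### Quenched infinite-volume limits -/

variable {d : ℕ}

/-- The indicator function of the event that all edges of `A` are open. -/
def allOpen (A : Finset (Edge d)) (ω : Config d) : ℝ := ∏ e ∈ A, if ω e = true then 1 else 0

lemma allOpen_nonneg (A : Finset (Edge d)) : 0 ≤ allOpen A := fun ω =>
  Finset.prod_nonneg fun e _ => by split_ifs <;> norm_num

lemma allOpen_le_one (A : Finset (Edge d)) (ω : Config d) : allOpen A ω ≤ 1 :=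
  Finset.prod_le_one (fun e _ => by split_ifs <;> norm_num)
    fun e _ => by split_ifs <;> norm_num

lemma monotone_allOpen (A : Finset (Edge d)) : Monotone (allOpen A) := by
  intro ω ω' h
  refine Finset.prod_le_prod (fun e _ => by split_ifs <;> norm_num) fun e _ => ?_
  by_cases h1 : ω e = true
  · have h2 : ω' e = true := Bool.eq_true_of_true_le (h1 ▸ h e)
    simp [h1, h2]
  · rw [if_neg h1]
    split_ifs <;> norm_num

lemma allOpen_singleton (e : Edge d) (ω : Config d) :
    allOpen {e} ω = if ω e = true then 1 else 0 := by
  simp [allOpen]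

lemma allOpen_glue {A E : Finset (Edge d)} (h : A ⊆ E) (ω π : Config d) :
    allOpen A (glue E ω π) = allOpen A ω :=
  Finset.prod_congr rfl fun e he => by simp [glue, h he]

/-- The function `∑_{e ∈ A} ω_e - ∏_{e ∈ A} ω_e` is increasing; the constant makes it nonnegative
when `A` is empty. -/
lemma monotone_sum_sub_allOpen (A : Finset (Edge d)) :
    Monotone (fun ω : Config d => ∑ e ∈ A, allOpen {e} ω + 1 - allOpen A ω) := by
  intro ω ω' h
  dsimp only
  by_cases h1 : ∀ e ∈ A, ω e = ω' e
  · have e1 : allOpen A ω = allOpen A ω' :=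
      Finset.prod_congr rfl fun e he => by rw [h1 e he]
    have e2 : ∑ e ∈ A, allOpen {e} ω = ∑ e ∈ A, allOpen {e} ω' :=
      Finset.sum_congr rfl fun e he => by rw [allOpen_singleton, allOpen_singleton, h1 e he]
    rw [e1, e2]
  · -- Some edge gets opened, so the sum rises by at least one and the product by at most one.
    push Not at h1
    obtain ⟨e, heA, hne⟩ := h1
    have hω : ω e = false ∧ ω' e = true := by
      have := h e
      rcases Bool.eq_false_or_eq_true (ω e) with h2 | h2
      · exact absurd (h2.trans (Bool.eq_true_of_true_le (h2 ▸ this)).symm) hne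
      · exact ⟨h2, by simpa [h2] using hne.symm⟩
    have hsum : ∑ e ∈ A, allOpen {e} ω + 1 ≤ ∑ e ∈ A, allOpen {e} ω' := by
      classical
      rw [← Finset.add_sum_erase _ _ heA, ← Finset.add_sum_erase A (fun e => allOpen {e} ω') heA]
      have : ∑ x ∈ A.erase e, allOpen {x} ω ≤ ∑ x ∈ A.erase e, allOpen {x} ω' :=
        Finset.sum_le_sum fun x _ => monotone_allOpen _ h
      have e1 : allOpen {e} ω = 0 := by simp [allOpen_singleton, hω.1]
      have e2 : allOpen {e} ω' = 1 := by simp [allOpen_singleton, hω.2]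
      rw [e1, e2]
      linarith
    have := allOpen_le_one A ω'
    have := allOpen_nonneg A ω
    simp only [Pi.zero_apply] at this
    linarith

section Mean

variable (β : ℝ≥0) (q : ℝ) (E : Finset (Edge d)) (π : Config d) (J : Media d)

lemma mean_add (f g : Config d → ℝ) :
    mean β q E π J (fun ω => f ω + g ω) = mean β q E π J f + mean β q E π J g := by
  simp only [mean, mul_add, Finset.sum_add_distrib, add_div]

lemma mean_sub (f g : Config d → ℝ) :
    mean β q E π J (fun ω => f ω - g ω) = mean β q E π J f - mean β q E π J g := by
  simp only [mean, mul_sub, Finset.sum_sub_distrib, sub_div]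

lemma mean_sum {ι : Type*} (s : Finset ι) (f : ι → Config d → ℝ) :
    mean β q E π J (fun ω => ∑ i ∈ s, f i ω) = ∑ i ∈ s, mean β q E π J (f i) := by
  simp only [mean, Finset.mul_sum]
  rw [Finset.sum_comm, Finset.sum_div]

variable {q}

lemma mean_const (hq : 1 ≤ q) (c : ℝ) : mean β q E π J (fun _ => c) = c := by
  rw [mean, ← Finset.sum_mul]
  exact mul_div_cancel_left₀ c (partitionFunction_pos β hq E π J).ne'

lemma mean_mono (hq : 1 ≤ q) {f g : Config d → ℝ} (h : f ≤ g) :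
    mean β q E π J f ≤ mean β q E π J g := by
  unfold mean
  have := partitionFunction_pos β hq E π J
  gcongr with A hA
  · exact weight_nonneg β hq E π J _
  · exact h _

lemma mean_nonneg (hq : 1 ≤ q) {f : Config d → ℝ} (h : 0 ≤ f) : 0 ≤ mean β q E π J f := by
  rw [← mean_const β E π J hq 0]
  exact mean_mono β E π J hq h

lemma mean_le_one (hq : 1 ≤ q) {f : Config d → ℝ} (h : f ≤ 1) : mean β q E π J f ≤ 1 := by
  rw [← mean_const β E π J hq 1]
  exact mean_mono β E π J hq h

lemma measurable_mean (q : ℝ) (f : Config d → ℝ) : Measurable fun J => mean β q E π J f := by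
  unfold mean partitionFunction
  exact (Finset.measurable_sum _ fun A _ => (measurable_weight β q E π _).mul_const _).div
    (Finset.measurable_sum _ fun A _ => measurable_weight β q E π _)

lemma integral_quenched (hq : 1 ≤ q) (f : Config d → ℝ) :
    ∫ ω, f ω ∂(quenched (interaction β) q E π J) =
      (∑ A ∈ E.powerset, weight (interaction β) q E π J (openOn A) * f (openOn A)) /
        partitionFunction (interaction β) q E π J := by
  unfold quenched
  rw [integral_finsetSum_measure fun A _ =>
    (integrable_dirac (by finiteness)).smul_measure ENNReal.ofReal_ne_top, Finset.sum_div]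
  refine Finset.sum_congr rfl fun A _ => ?_
  rw [integral_smul_measure, integral_dirac, ENNReal.toReal_ofReal, smul_eq_mul]
  · ring
  · exact div_nonneg (weight_nonneg β hq E π J _) (partitionFunction_pos β hq E π J).le

lemma integral_quenched_allOpen (hq : 1 ≤ q) {A : Finset (Edge d)} (h : A ⊆ E) :
    ∫ ω, allOpen A ω ∂(quenched (interaction β) q E π J) = mean β q E π J (allOpen A) := by
  rw [integral_quenched β E π J hq, mean]
  simp_rw [allOpen_glue h]

end Mean

section Limits

variable (β : ℝ≥0) {q : ℝ} (hq : 1 ≤ q) (J : Media d)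

include hq in
lemma monotone_mean_free {f : Config d → ℝ} (hf : Monotone f) (hf0 : 0 ≤ f) :
    Monotone fun E => mean β q E (free d) J f := fun _ _ h =>
  mean_le_mean hq le_rfl le_rfl (fun _ _ _ => rfl) (fun _ he he' => absurd (h he') he) J hf hf0

include hq in
lemma antitone_mean_wired {f : Config d → ℝ} (hf : Monotone f) (hf0 : 0 ≤ f) :
    Antitone fun E => mean β q E (wired d) J f := fun _ _ h =>
  mean_le_mean hq le_rfl le_rfl (fun _ he he' => absurd (h he') he) (fun _ _ _ => rfl) J hf hf0

end Limits

lemma mean_free_le_wired {q : ℝ} (hq : 1 ≤ q) (β : ℝ≥0) (E : Finset (Edge d)) (J : Media d)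
    {f : Config d → ℝ} (hf : Monotone f) (hf0 : 0 ≤ f) :
    mean β q E (free d) J f ≤ mean β q E (wired d) J f :=
  mean_le_mean hq le_rfl (fun _ => Bool.false_le _) (fun _ h h' => absurd h' h)
    (fun _ h h' => absurd h' h) J hf hf0

lemma mean_mono_beta {q : ℝ} (hq : 1 ≤ q) {β₁ β₂ : ℝ≥0} (h : β₁ ≤ β₂) (E : Finset (Edge d))
    (π : Config d) (J : Media d) {f : Config d → ℝ} (hf : Monotone f) (hf0 : 0 ≤ f) :
    mean β₁ q E π J f ≤ mean β₂ q E π J f :=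
  mean_le_mean hq h le_rfl (fun _ h h' => absurd h' h) (fun _ h h' => absurd h' h) J hf hf0

/-- The free and the wired measure differ on the event that all edges of `A` are open by at most
the sum of their differences on single edges. -/
lemma mean_wired_sub_free_le {q : ℝ} (hq : 1 ≤ q) (β : ℝ≥0) (E : Finset (Edge d)) (J : Media d)
    (A : Finset (Edge d)) :
    mean β q E (wired d) J (allOpen A) - mean β q E (free d) J (allOpen A) ≤
      ∑ e ∈ A, (mean β q E (wired d) J (allOpen {e}) - mean β q E (free d) J (allOpen {e})) := by
  have h := mean_free_le_wired hq β E J (monotone_sum_sub_allOpen A) fun ω => by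
    have h1 : (0 : ℝ) ≤ ∑ e ∈ A, allOpen {e} ω :=
      Finset.sum_nonneg fun e _ => allOpen_nonneg {e} ω
    have h2 := allOpen_le_one A ω
    simp only [Pi.zero_apply]
    linarith
  rw [mean_sub, mean_sub, mean_add, mean_add, mean_sum, mean_sum, mean_const _ _ _ _ hq,
    mean_const _ _ _ _ hq] at h
  rw [Finset.sum_sub_distrib]
  linarith

/-- The infinite-volume free probability, for given media, that all edges of `A` are open. -/
def freeProb (β : ℝ≥0) (q : ℝ) (J : Media d) (A : Finset (Edge d)) : ℝ :=
  ⨆ E : Finset (Edge d), mean β q E (free d) J (allOpen A)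

/-- The infinite-volume wired probability, for given media, that all edges of `A` are open. -/
def wiredProb (β : ℝ≥0) (q : ℝ) (J : Media d) (A : Finset (Edge d)) : ℝ :=
  ⨅ E : Finset (Edge d), mean β q E (wired d) J (allOpen A)

section Prob

variable {q : ℝ} (hq : 1 ≤ q) (β : ℝ≥0) (J : Media d) (A : Finset (Edge d))

include hq

lemma bddAbove_mean_free :
    BddAbove (Set.range fun E : Finset (Edge d) => mean β q E (free d) J (allOpen A)) :=
  ⟨1, by rintro _ ⟨E, rfl⟩; exact mean_le_one β E _ J hq (allOpen_le_one A)⟩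

lemma bddBelow_mean_wired :
    BddBelow (Set.range fun E : Finset (Edge d) => mean β q E (wired d) J (allOpen A)) :=
  ⟨0, by rintro _ ⟨E, rfl⟩; exact mean_nonneg β E _ J hq (allOpen_nonneg A)⟩

lemma tendsto_freeProb :
    Tendsto (fun E => mean β q E (free d) J (allOpen A)) atTop (𝓝 (freeProb β q J A)) :=
  tendsto_atTop_ciSup (monotone_mean_free β hq J (monotone_allOpen A) (allOpen_nonneg A))
    (bddAbove_mean_free hq β J A)

lemma tendsto_wiredProb :
    Tendsto (fun E => mean β q E (wired d) J (allOpen A)) atTop (𝓝 (wiredProb β q J A)) :=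
  tendsto_atTop_ciInf (antitone_mean_wired β hq J (monotone_allOpen A) (allOpen_nonneg A))
    (bddBelow_mean_wired hq β J A)

lemma mean_le_freeProb (E : Finset (Edge d)) :
    mean β q E (free d) J (allOpen A) ≤ freeProb β q J A :=
  le_ciSup (bddAbove_mean_free hq β J A) E

lemma wiredProb_le_mean (E : Finset (Edge d)) :
    wiredProb β q J A ≤ mean β q E (wired d) J (allOpen A) :=
  ciInf_le (bddBelow_mean_wired hq β J A) E

lemma freeProb_nonneg : 0 ≤ freeProb β q J A :=
  (mean_nonneg β ∅ _ J hq (allOpen_nonneg A)).trans (mean_le_freeProb hq β J A ∅)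

lemma wiredProb_le_one : wiredProb β q J A ≤ 1 :=
  (wiredProb_le_mean hq β J A ∅).trans (mean_le_one β ∅ _ J hq (allOpen_le_one A))

lemma freeProb_le_wiredProb : freeProb β q J A ≤ wiredProb β q J A :=
  le_of_tendsto_of_tendsto' (tendsto_freeProb hq β J A) (tendsto_wiredProb hq β J A)
    fun E => mean_free_le_wired hq β E J (monotone_allOpen A) (allOpen_nonneg A)

lemma wiredProb_nonneg : 0 ≤ wiredProb β q J A :=
  (freeProb_nonneg hq β J A).trans (freeProb_le_wiredProb hq β J A)

lemma freeProb_le_one : freeProb β q J A ≤ 1 :=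
  (freeProb_le_wiredProb hq β J A).trans (wiredProb_le_one hq β J A)

lemma monotone_wiredProb : Monotone fun β => wiredProb β q J A := fun _ _ h =>
  ciInf_mono (bddBelow_mean_wired hq _ J A) fun E =>
    mean_mono_beta hq h E _ J (monotone_allOpen A) (allOpen_nonneg A)

lemma wiredProb_sub_freeProb_le :
    wiredProb β q J A - freeProb β q J A ≤
      ∑ e ∈ A, (wiredProb β q J {e} - freeProb β q J {e}) :=
  le_of_tendsto_of_tendsto' ((tendsto_wiredProb hq β J A).sub (tendsto_freeProb hq β J A))
    (tendsto_finsetSum _ fun e _ =>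
      (tendsto_wiredProb hq β J {e}).sub (tendsto_freeProb hq β J {e}))
    fun E => mean_wired_sub_free_le hq β E J A

omit hq in
lemma measurable_freeProb (q : ℝ) : Measurable fun J => freeProb β q J A :=
  Measurable.iSup fun E => measurable_mean β E _ q _

omit hq in
lemma measurable_wiredProb (q : ℝ) : Measurable fun J => wiredProb β q J A :=
  Measurable.iInf fun E => measurable_mean β E _ q _

end Prob

lemma mem_edgesTouching {Λ : Finset (Fin d → ℤ)} {e : Edge d} :
    e ∈ edgesTouching Λ ↔ ∃ x ∈ Λ, x ∈ e.1 := by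
  simp [edgesTouching]

lemma mem_symBox {N : ℕ} {x : Fin d → ℤ} : x ∈ symBox d N ↔ ∀ i, |x i| ≤ N := by
  simp only [symBox, Finset.mem_Icc, Pi.le_def, abs_le, forall_and]

lemma tendsto_edgesTouching_symBox :
    Tendsto (fun N => edgesTouching (symBox d N)) atTop atTop := by
  refine tendsto_atTop_finset_of_monotone (fun M N h e he => ?_) fun e => ?_
  · rw [mem_edgesTouching] at he ⊢
    obtain ⟨x, hx, hxe⟩ := he
    refine ⟨x, ?_, hxe⟩
    rw [mem_symBox] at hx ⊢
    exact fun i => (hx i).trans (by exact_mod_cast h)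
  · obtain ⟨x, hx⟩ : ∃ x, x ∈ e.1 := by
      induction h : e.1 with
      | _ x y => exact ⟨x, by simp⟩
    refine ⟨∑ i, (x i).natAbs, mem_edgesTouching.mpr ⟨x, mem_symBox.mpr fun i => ?_, hx⟩⟩
    rw [Int.abs_eq_natAbs]
    exact_mod_cast Finset.single_le_sum (f := fun i => (x i).natAbs) (fun _ _ => Nat.zero_le _)
      (Finset.mem_univ i)

end

section


/-! ### Weak convergence of the joint laws -/

variable {d : ℕ}

/-- The indicator that the edge `e` is open, as a continuous function. -/
def openIndicator (e : Edge d) : C(Config d, ℝ) :=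
  ⟨fun ω => if ω e = true then 1 else 0,
    (continuous_of_discreteTopology (f := fun b : Bool => if b = true then (1 : ℝ) else 0)).comp
      (continuous_apply e)⟩

lemma exists_eq_allOpen_of_mem_closure {g : C(Config d, ℝ)}
    (hg : g ∈ Submonoid.closure (Set.range (openIndicator (d := d)))) :
    ∃ A, ⇑g = allOpen A := by
  classical
  induction hg using Submonoid.closure_induction with
  | mem x hx =>
    obtain ⟨e, rfl⟩ := hx
    exact ⟨{e}, by funext ω; rw [allOpen_singleton]; rfl⟩
  | one => exact ⟨∅, by funext ω; simp [allOpen]⟩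
  | mul x y _ _ hx hy =>
    obtain ⟨A, hA⟩ := hx
    obtain ⟨B, hB⟩ := hy
    refine ⟨A ∪ B, ?_⟩
    funext ω
    rw [ContinuousMap.mul_apply, hA, hB]
    simp only [allOpen, Finset.prod_boole, ite_zero_mul_ite_zero, mul_one, Finset.mem_union,
      or_imp, forall_and]

/-- The increasing cylinder functions `allOpen A` span a dense subspace of the continuous
functions, by the Stone-Weierstrass theorem. -/
lemma dense_span_allOpen :
    (Submodule.span ℝ {g : C(Config d, ℝ) | ∃ A, ⇑g = allOpen A}).topologicalClosure = ⊤ := by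
  have hsep : (Algebra.adjoin ℝ (Set.range (openIndicator (d := d)))).SeparatesPoints := by
    intro ω ω' h
    obtain ⟨e, he⟩ := Function.ne_iff.mp h
    refine ⟨_, ⟨openIndicator e, Algebra.subset_adjoin ⟨e, rfl⟩, rfl⟩, ?_⟩
    simp only [openIndicator, ContinuousMap.coe_mk]
    rcases Bool.eq_false_or_eq_true (ω e) with h1 | h1 <;>
      rcases Bool.eq_false_or_eq_true (ω' e) with h2 | h2 <;> simp_all
  have hSW := ContinuousMap.subalgebra_topologicalClosure_eq_top_of_separatesPoints _ hsep
  rw [eq_top_iff]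
  intro g _
  have hg : g ∈ (Algebra.adjoin ℝ (Set.range (openIndicator (d := d)))).topologicalClosure := by
    rw [hSW]; trivial
  rw [← SetLike.mem_coe, Submodule.topologicalClosure_coe]
  rw [← SetLike.mem_coe, Subalgebra.topologicalClosure_coe] at hg
  refine closure_mono ?_ hg
  rw [← Subalgebra.coe_toSubmodule, Algebra.adjoin_eq_span]
  exact Submodule.span_mono fun x hx => exists_eq_allOpen_of_mem_closure hx

lemma integrable_continuousMap {X : Type*} [TopologicalSpace X] [CompactSpace X]
    [MeasurableSpace X] [OpensMeasurableSpace X] (μ : Measure X) [IsFiniteMeasure μ] (g : C(X, ℝ)) :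
    Integrable g μ :=
  (BoundedContinuousFunction.mkOfCompact g).integrable μ

lemma norm_integral_le_norm {X : Type*} [TopologicalSpace X] [CompactSpace X]
    [MeasurableSpace X] (μ : Measure X) [IsProbabilityMeasure μ] (g : C(X, ℝ)) :
    ‖∫ x, g x ∂μ‖ ≤ ‖g‖ := by
  simpa using norm_integral_le_of_norm_le_const (μ := μ) (ae_of_all _ fun x => g.norm_coe_le_norm x)

/-- The functions `allOpen A` decide whether two families of probability measures merge. -/
lemma tendsto_integral_sub_of_allOpen {ι : Type*} {l : Filter ι} {μ ν : ι → Measure (Config d)}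
    [∀ i, IsProbabilityMeasure (μ i)] [∀ i, IsProbabilityMeasure (ν i)]
    (h : ∀ A, Tendsto (fun i => ∫ ω, allOpen A ω ∂μ i - ∫ ω, allOpen A ω ∂ν i) l (𝓝 0))
    (g : C(Config d, ℝ)) :
    Tendsto (fun i => ∫ ω, g ω ∂μ i - ∫ ω, g ω ∂ν i) l (𝓝 0) := by
  have hspan : ∀ g ∈ Submodule.span ℝ {g : C(Config d, ℝ) | ∃ A, ⇑g = allOpen A},
      Tendsto (fun i => ∫ ω, g ω ∂μ i - ∫ ω, g ω ∂ν i) l (𝓝 0) := by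
    intro g hg
    induction hg using Submodule.span_induction with
    | mem x hx => obtain ⟨A, hA⟩ := hx; rw [hA]; exact h A
    | zero => simpa using tendsto_const_nhds
    | add x y _ _ hx hy =>
      refine (hx.add hy).congr' (Eventually.of_forall fun i => ?_) |>.trans (by simp)
      simp only [ContinuousMap.add_apply]
      rw [integral_add (integrable_continuousMap _ x) (integrable_continuousMap _ y),
        integral_add (integrable_continuousMap _ x) (integrable_continuousMap _ y)]
      ring
    | smul a x _ hx =>
      refine (hx.const_mul a).congr' (Eventually.of_forall fun i => ?_) |>.trans (by simp)
      simp only [ContinuousMap.smul_apply, smul_eq_mul, integral_const_mul]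
      ring
  rw [Metric.tendsto_nhds]
  intro ε hε
  have hg : g ∈ closure
      (Submodule.span ℝ {g : C(Config d, ℝ) | ∃ A, ⇑g = allOpen A} : Set C(Config d, ℝ)) := by
    rw [← Submodule.topologicalClosure_coe, dense_span_allOpen]; trivial
  obtain ⟨k, hk, hgk⟩ := Metric.mem_closure_iff.mp hg (ε / 4) (by positivity)
  filter_upwards [Metric.tendsto_nhds.mp (hspan k hk) (ε / 4) (by positivity)] with i hi
  rw [dist_zero_right, Real.norm_eq_abs] at hi ⊢
  rw [dist_eq_norm] at hgk
  have key (m : Measure (Config d)) [IsProbabilityMeasure m] :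
      |∫ ω, g ω ∂m - ∫ ω, k ω ∂m| < ε / 4 := by
    rw [← integral_sub (integrable_continuousMap _ g) (integrable_continuousMap _ k)]
    exact (norm_integral_le_norm m (g - k)).trans_lt hgk
  have h1 := abs_lt.mp (key (μ i))
  have h2 := abs_lt.mp (key (ν i))
  have h3 := abs_lt.mp hi
  rw [abs_lt]
  constructor <;> linarith

/-- If the mean of every `allOpen A` converges, the mean of every continuous function does. -/
lemma exists_tendsto_integral {μ : ℕ → Measure (Config d)} [∀ i, IsProbabilityMeasure (μ i)]
    (h : ∀ A, ∃ x, Tendsto (fun n => ∫ ω, allOpen A ω ∂μ n) atTop (𝓝 x)) (g : C(Config d, ℝ)) :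
    ∃ x, Tendsto (fun n => ∫ ω, g ω ∂μ n) atTop (𝓝 x) := by
  refine cauchySeq_tendsto_of_complete ?_
  have := tendsto_integral_sub_of_allOpen (l := atTop ×ˢ atTop) (μ := fun p : ℕ × ℕ => μ p.1)
    (ν := fun p : ℕ × ℕ => μ p.2) (fun A => by
      obtain ⟨x, hx⟩ := h A
      simpa using (hx.comp tendsto_fst).sub (hx.comp tendsto_snd)) g
  rw [cauchySeq_iff_tendsto_dist_atTop_0, ← prod_atTop_atTop_eq]
  simpa [Real.dist_eq] using this.abs

section Joint

variable (ρ : Measure unitInterval) [IsProbabilityMeasure ρ] {q : ℝ} (hq : 1 ≤ q) (β : ℝ≥0)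

lemma integral_jointFK (E : Finset (Edge d)) (π : Config d) (F : C(Media d × Config d, ℝ)) :
    ∫ x, F x ∂(jointFK ρ hq β E π : Measure (Media d × Config d)) =
      ∫ J, ∫ ω, F (J, ω) ∂(quenched (interaction β) q E π J) ∂(mediaLaw d ρ) := by
  have := isMarkovKernel_quenchedKernel (d := d) β hq E π
  change ∫ x, F x ∂((mediaLaw d ρ) ⊗ₘ (quenchedKernel β q E π)) = _
  rw [Measure.integral_compProd (integrable_continuousMap _ F)]
  rfl

include hq in
lemma measurable_integral_quenched (E : Finset (Edge d)) (π : Config d)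
    (F : C(Media d × Config d, ℝ)) :
    Measurable fun J => ∫ ω, F (J, ω) ∂(quenched (interaction β) q E π J) := by
  simp_rw [fun J => integral_quenched β E π J hq fun ω => F (J, ω)]
  unfold partitionFunction
  refine (Finset.measurable_sum _ fun A _ => (measurable_weight β q E π _).mul ?_).div
    (Finset.measurable_sum _ fun A _ => measurable_weight β q E π _)
  exact F.continuous.measurable.comp (measurable_id.prodMk measurable_const)

/-- The section of a continuous function at the media `J`. -/
def sectionAt (F : C(Media d × Config d, ℝ)) (J : Media d) : C(Config d, ℝ) :=
  F.comp ⟨fun ω => (J, ω), by fun_prop⟩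

include hq in
lemma norm_integral_quenched_le (E : Finset (Edge d)) (π : Config d)
    (F : C(Media d × Config d, ℝ)) (J : Media d) :
    ‖∫ ω, F (J, ω) ∂(quenched (interaction β) q E π J)‖ ≤ ‖F‖ := by
  have := isProbabilityMeasure_quenched β hq E π J
  refine (norm_integral_le_norm _ (sectionAt F J)).trans ?_
  exact (ContinuousMap.norm_le _ (norm_nonneg _)).mpr fun ω => F.norm_coe_le_norm _

/-- Convergence of all quenched probabilities that the edges of a finite set are open implies
convergence of the joint laws. -/
lemma exists_isInfiniteVolumeLimit {π : Config d}
    (h : ∀ J A, ∃ x, Tendsto (fun N => ∫ ω, allOpen A ω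
      ∂(quenched (interaction β) q (edgesTouching (symBox d N)) π J)) atTop (𝓝 x)) :
    ∃ Θ, IsInfiniteVolumeLimit ρ hq β π Θ := by
  have prob := fun (N : ℕ) (J : Media d) =>
    isProbabilityMeasure_quenched β hq (edgesTouching (symBox d N)) π J
  have hF : ∀ F : C(Media d × Config d, ℝ), ∃ y, Tendsto (fun N => ∫ x, F x ∂(jointFK ρ hq β
      (edgesTouching (symBox d N)) π : Measure (Media d × Config d))) atTop (𝓝 y) := by
    intro F
    choose x hx using fun J => exists_tendsto_integral (h J) (sectionAt F J)
    refine ⟨∫ J, x J ∂(mediaLaw d ρ), ?_⟩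
    simp_rw [integral_jointFK]
    exact tendsto_integral_of_dominated_convergence (fun _ => ‖F‖)
      (fun N => (measurable_integral_quenched hq β _ π F).aestronglyMeasurable)
      (integrable_const _) (fun N => ae_of_all _ fun J => norm_integral_quenched_le hq β _ π F J)
      (ae_of_all _ hx)
  -- By compactness the sequence has a cluster point, and it is the limit.
  obtain ⟨Θ, hΘ⟩ := exists_clusterPt_of_compactSpace
    (map (fun N => jointFK ρ hq β (edgesTouching (symBox d N)) π) atTop)
  refine ⟨Θ, ?_⟩
  unfold IsInfiniteVolumeLimit
  rw [ProbabilityMeasure.tendsto_iff_forall_integral_tendsto]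
  intro F
  obtain ⟨y, hy⟩ := hF F.toContinuousMap
  have hcl : MapClusterPt (∫ x, F x ∂(Θ : Measure (Media d × Config d))) atTop
      (fun N => ∫ x, F x ∂(jointFK ρ hq β (edgesTouching (symBox d N)) π :
        Measure (Media d × Config d))) :=
    MapClusterPt.continuousAt_comp
      (f := fun μ : ProbabilityMeasure (Media d × Config d) =>
        ∫ x, F x ∂(μ : Measure (Media d × Config d)))
      (ProbabilityMeasure.continuous_integral_boundedContinuousFunction F).continuousAt hΘ
  have : (∫ x, F x ∂(Θ : Measure (Media d × Config d))) = y :=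
    eq_of_nhds_neBot (hcl.neBot.mono (inf_le_inf_left _ hy))
  rw [this]
  exact hy

/-- If almost surely the quenched probabilities that the edges of a finite set are open merge, then
the limits of the joint laws coincide. -/
lemma eq_of_isInfiniteVolumeLimit {π π' : Config d}
    (h : ∀ᵐ J ∂(mediaLaw d ρ), ∀ A, Tendsto (fun N =>
      ∫ ω, allOpen A ω ∂(quenched (interaction β) q (edgesTouching (symBox d N)) π J) -
      ∫ ω, allOpen A ω ∂(quenched (interaction β) q (edgesTouching (symBox d N)) π' J))
      atTop (𝓝 0))
    {Θ Θ' : ProbabilityMeasure (Media d × Config d)} (hΘ : IsInfiniteVolumeLimit ρ hq β π Θ)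
    (hΘ' : IsInfiniteVolumeLimit ρ hq β π' Θ') : Θ = Θ' := by
  have prob := fun (N : ℕ) (π : Config d) (J : Media d) =>
    isProbabilityMeasure_quenched β hq (edgesTouching (symBox d N)) π J
  refine tendsto_nhds_unique hΘ ?_
  unfold IsInfiniteVolumeLimit at hΘ'
  rw [ProbabilityMeasure.tendsto_iff_forall_integral_tendsto] at hΘ' ⊢
  intro F
  have hlim : Tendsto (fun N : ℕ =>
      ∫ x, F x ∂(jointFK ρ hq β (edgesTouching (symBox d N)) π : Measure (Media d × Config d)) -
      ∫ x, F x ∂(jointFK ρ hq β (edgesTouching (symBox d N)) π' :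
        Measure (Media d × Config d))) atTop (𝓝 0) := by
    have hint (N : ℕ) (π : Config d) : Integrable (fun J => ∫ ω, F.toContinuousMap (J, ω)
        ∂(quenched (interaction β) q (edgesTouching (symBox d N)) π J)) (mediaLaw d ρ) :=
      Integrable.of_bound (measurable_integral_quenched hq β _ π _).aestronglyMeasurable
        ‖F.toContinuousMap‖ (ae_of_all _ fun J => norm_integral_quenched_le hq β _ π _ J)
    have hdom := tendsto_integral_of_dominated_convergence (μ := mediaLaw d ρ)
      (F := fun N J =>
        ∫ ω, F.toContinuousMap (J, ω)
          ∂(quenched (interaction β) q (edgesTouching (symBox d N)) π J) -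
        ∫ ω, F.toContinuousMap (J, ω)
          ∂(quenched (interaction β) q (edgesTouching (symBox d N)) π' J))
      (f := fun _ => 0) (fun _ => ‖F.toContinuousMap‖ + ‖F.toContinuousMap‖)
      (fun N => ((hint N π).sub (hint N π')).aestronglyMeasurable)
      (integrable_const _)
      (fun N => ae_of_all _ fun J => (norm_sub_le _ _).trans
        (add_le_add (norm_integral_quenched_le hq β _ π _ J)
          (norm_integral_quenched_le hq β _ π' _ J)))
      (h.mono fun J hJ => tendsto_integral_sub_of_allOpen hJ (sectionAt F.toContinuousMap J))
    rw [integral_zero] at hdom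
    refine hdom.congr fun N => ?_
    rw [integral_sub (hint N π) (hint N π'), ← integral_jointFK ρ hq, ← integral_jointFK ρ hq]
    rfl
  simpa using hlim.add (hΘ' F)

end Joint

lemma tendsto_integral_free {q : ℝ} (hq : 1 ≤ q) (β : ℝ≥0) (J : Media d) (A : Finset (Edge d)) :
    Tendsto (fun N => ∫ ω, allOpen A ω
      ∂(quenched (interaction β) q (edgesTouching (symBox d N)) (free d) J)) atTop
      (𝓝 (freeProb β q J A)) := by
  refine ((tendsto_freeProb hq β J A).comp tendsto_edgesTouching_symBox).congr' ?_
  filter_upwards [tendsto_edgesTouching_symBox.eventually_ge_atTop A] with N hN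
  exact (integral_quenched_allOpen β _ _ J hq hN).symm

lemma tendsto_integral_wired {q : ℝ} (hq : 1 ≤ q) (β : ℝ≥0) (J : Media d) (A : Finset (Edge d)) :
    Tendsto (fun N => ∫ ω, allOpen A ω
      ∂(quenched (interaction β) q (edgesTouching (symBox d N)) (wired d) J)) atTop
      (𝓝 (wiredProb β q J A)) := by
  refine ((tendsto_wiredProb hq β J A).comp tendsto_edgesTouching_symBox).congr' ?_
  filter_upwards [tendsto_edgesTouching_symBox.eventually_ge_atTop A] with N hN
  exact (integral_quenched_allOpen β _ _ J hq hN).symm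

end

section


/-! ### Comparing the free and the wired pressure -/

/-- Jensen's inequality for the exponential function, in the form of the Gibbs inequality. -/
lemma sum_mul_div_le_log {ι : Type*} (s : Finset ι) (w L : ι → ℝ) (hw : ∀ i ∈ s, 0 ≤ w i)
    (hZ : 0 < ∑ i ∈ s, w i) (hZ' : 0 < ∑ i ∈ s, w i * Real.exp (L i)) :
    (∑ i ∈ s, w i * L i) / ∑ i ∈ s, w i ≤
      Real.log (∑ i ∈ s, w i * Real.exp (L i)) - Real.log (∑ i ∈ s, w i) := by
  have h := convexOn_exp.map_sum_le (t := s) (w := fun i => w i / ∑ j ∈ s, w j) (p := L)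
    (fun i hi => div_nonneg (hw i hi) hZ.le) (by rw [← Finset.sum_div, div_self hZ.ne'])
    (fun i _ => Set.mem_univ _)
  simp only [smul_eq_mul, div_mul_eq_mul_div, ← Finset.sum_div] at h
  rw [← Real.log_div hZ'.ne' hZ.ne', Real.le_log_iff_exp_le (div_pos hZ' hZ)]
  exact h

/-- The logarithm of the ratio of the odds `e^{β t} - 1` of an open edge at two inverse
temperatures; it vanishes at `t = 0`, where both odds do. -/
def logOddsRatio (β β' : ℝ≥0) (t : unitInterval) : ℝ :=
  Real.log ((Real.exp (β' * t) - 1) / (Real.exp (β * t) - 1))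

lemma measurable_logOddsRatio (β β' : ℝ≥0) : Measurable (logOddsRatio β β') := by
  unfold logOddsRatio
  fun_prop

section LogOdds

variable {β β' : ℝ≥0} (hβ : 0 < β) (h : β ≤ β') (t : unitInterval)

include hβ

lemma exp_mul_sub_one_pos (ht : t ≠ 0) : 0 < Real.exp (β * t) - 1 := by
  have ht' : (0 : ℝ) < t := unitInterval.pos_iff_ne_zero.mpr ht
  have : 0 < (β : ℝ) * t := mul_pos (by exact_mod_cast hβ) ht'
  linarith [Real.add_one_lt_exp this.ne']

include h

lemma interaction_eq_mul_exp :
    interaction β' t =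
      interaction β t * Real.exp (logOddsRatio β β' t - ((β' : ℝ) - β) * t) := by
  by_cases ht : t = 0
  · simp [interaction, ht]
  have h1 := exp_mul_sub_one_pos hβ t ht
  have h2 := exp_mul_sub_one_pos (hβ.trans_le h) t ht
  have e1 : Real.exp (-(β' * t : ℝ)) * Real.exp (β' * t) = 1 := by rw [← Real.exp_add]; simp
  have e2 : Real.exp (-(β * t : ℝ)) * Real.exp (β * t) = 1 := by rw [← Real.exp_add]; simp
  have e3 : Real.exp (-(((β' : ℝ) - β) * t)) = Real.exp (-(β' * t : ℝ)) * Real.exp (β * t) := by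
    rw [← Real.exp_add]; congr 1; ring
  have i1 : interaction β t = Real.exp (-(β * t : ℝ)) * (Real.exp (β * t) - 1) := by
    unfold interaction; linarith
  have i2 : interaction β' t = Real.exp (-(β' * t : ℝ)) * (Real.exp (β' * t) - 1) := by
    unfold interaction; linarith
  rw [sub_eq_add_neg, Real.exp_add, logOddsRatio, Real.exp_log (div_pos h2 h1), e3, i1, i2]
  calc _ = (Real.exp (-(β * t : ℝ)) * Real.exp (β * t)) *
        (Real.exp (-(β' * t : ℝ)) * (Real.exp (β' * t) - 1)) := by rw [e2, one_mul]
    _ = _ := by field_simp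

omit hβ h in
lemma one_sub_interaction_eq_mul_exp :
    1 - interaction β' t = (1 - interaction β t) * Real.exp (0 - ((β' : ℝ) - β) * t) := by
  unfold interaction
  rw [sub_sub_cancel, sub_sub_cancel, ← Real.exp_add]
  congr 1
  ring

lemma mul_le_logOddsRatio : ((β' : ℝ) - β) * t ≤ logOddsRatio β β' t := by
  by_cases ht : t = 0
  · simp [logOddsRatio, ht]
  have h1 := exp_mul_sub_one_pos hβ t ht
  have h2 := exp_mul_sub_one_pos (hβ.trans_le h) t ht
  have h3 : (1 : ℝ) ≤ Real.exp (((β' : ℝ) - β) * t) :=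
    Real.one_le_exp (mul_nonneg (sub_nonneg.mpr (by exact_mod_cast h)) t.2.1)
  have h4 : Real.exp (β' * t : ℝ) = Real.exp (((β' : ℝ) - β) * t) * Real.exp (β * t) := by
    rw [← Real.exp_add]; congr 1; ring
  rw [logOddsRatio, Real.le_log_iff_exp_le (div_pos h2 h1), le_div_iff₀ h1, h4]
  linarith

lemma logOddsRatio_nonneg : 0 ≤ logOddsRatio β β' t :=
  (mul_nonneg (sub_nonneg.mpr (by exact_mod_cast h)) t.2.1).trans (mul_le_logOddsRatio hβ h t)

lemma logOddsRatio_le : logOddsRatio β β' t ≤ ((β' : ℝ) - β) * (Real.exp β' / β) := by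
  have hβ0 : (0 : ℝ) < β := by exact_mod_cast hβ
  have hsub : (0 : ℝ) ≤ (β' : ℝ) - β := sub_nonneg.mpr (by exact_mod_cast h)
  by_cases ht : t = 0
  · have h0 : logOddsRatio β β' t = 0 := by simp [logOddsRatio, ht]
    rw [h0]
    positivity
  have ht' : (0 : ℝ) < t := unitInterval.pos_iff_ne_zero.mpr ht
  have h1 := exp_mul_sub_one_pos hβ t ht
  have h2 := exp_mul_sub_one_pos (hβ.trans_le h) t ht
  have h3 : (β : ℝ) * t ≤ Real.exp (β * t) - 1 := by linarith [Real.add_one_le_exp (β * t : ℝ)]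
  have h4 : Real.exp (β' * t : ℝ) - Real.exp (β * t) ≤ ((β' : ℝ) - β) * t * Real.exp β' := by
    have e1 : Real.exp (β * t : ℝ) = Real.exp (-(((β' : ℝ) - β) * t)) * Real.exp (β' * t) := by
      rw [← Real.exp_add]; congr 1; ring
    have e2 := Real.add_one_le_exp (-(((β' : ℝ) - β) * t))
    have e3 : Real.exp (β' * t : ℝ) ≤ Real.exp β' :=
      Real.exp_le_exp.mpr (mul_le_of_le_one_right β'.2 t.2.2)
    have e4 := Real.exp_pos (β' * t : ℝ)
    calc _ = (1 - Real.exp (-(((β' : ℝ) - β) * t))) * Real.exp (β' * t) := by rw [e1]; ring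
      _ ≤ (((β' : ℝ) - β) * t) * Real.exp (β' * t) :=
        mul_le_mul_of_nonneg_right (by linarith) e4.le
      _ ≤ _ := mul_le_mul_of_nonneg_left e3 (mul_nonneg hsub ht'.le)
  calc logOddsRatio β β' t
      ≤ (Real.exp (β' * t) - 1) / (Real.exp (β * t) - 1) - 1 :=
        Real.log_le_sub_one_of_pos (div_pos h2 h1)
    _ = (Real.exp (β' * t) - Real.exp (β * t)) / (Real.exp (β * t) - 1) := by
        rw [div_sub_one h1.ne']; congr 1; ring
    _ ≤ (((β' : ℝ) - β) * t * Real.exp β') / (β * t) :=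
        div_le_div₀ (by positivity) h4 (by positivity) h3
    _ = _ := by field_simp

end LogOdds

variable {d : ℕ}

section Pressure

variable {q : ℝ} (hq : 1 ≤ q) {β β' : ℝ≥0} (hβ : 0 < β) (h : β ≤ β') (E : Finset (Edge d))
  (π : Config d) (J : Media d)

/-- The logarithm of the ratio of the weights of `ω` at two inverse temperatures. -/
def logWeightRatio (β β' : ℝ≥0) (E : Finset (Edge d)) (J : Media d) (ω : Config d) : ℝ :=
  ∑ e ∈ E, logOddsRatio β β' (J e) * allOpen {e} ω - ∑ e ∈ E, ((β' : ℝ) - β) * J e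

include hβ h in
lemma boltzmann_eq_mul_exp (ω : Config d) :
    boltzmann (interaction β') q E J ω =
      boltzmann (interaction β) q E J ω * Real.exp (logWeightRatio β β' E J ω) := by
  unfold boltzmann logWeightRatio
  rw [← Finset.sum_sub_distrib, Real.exp_sum, mul_right_comm, ← Finset.prod_mul_distrib]
  congr 1
  refine Finset.prod_congr rfl fun e _ => ?_
  rw [allOpen_singleton]
  split_ifs
  · rw [mul_one]; exact interaction_eq_mul_exp hβ h _
  · rw [mul_zero]; exact one_sub_interaction_eq_mul_exp _

include hq in
lemma mean_logWeightRatio (β₀ : ℝ≥0) :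
    mean β₀ q E π J (logWeightRatio β β' E J) =
      ∑ e ∈ E, logOddsRatio β β' (J e) * mean β₀ q E π J (allOpen {e}) -
        ∑ e ∈ E, ((β' : ℝ) - β) * J e := by
  have hmul (c : ℝ) (f : Config d → ℝ) :
      mean β₀ q E π J (fun ω => c * f ω) = c * mean β₀ q E π J f := by
    simp only [mean, ← mul_div_assoc, Finset.mul_sum]
    congr 1
    exact Finset.sum_congr rfl fun A _ => by ring
  unfold logWeightRatio
  rw [mean_sub, mean_sum, mean_const _ _ _ _ hq]
  simp_rw [hmul]

include hq hβ h

lemma mean_logWeightRatio_le_log :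
    mean β q E π J (logWeightRatio β β' E J) ≤
      Real.log (partitionFunction (interaction β') q E π J) -
        Real.log (partitionFunction (interaction β) q E π J) := by
  have hZ := partitionFunction_pos β hq E π J
  have hZ' := partitionFunction_pos β' hq E π J
  rw [partitionFunction_eq] at hZ hZ'
  rw [mean_eq, partitionFunction_eq, partitionFunction_eq]
  simp_rw [boltzmann_eq_mul_exp hβ h E J] at hZ' ⊢
  exact sum_mul_div_le_log _ _ _ (fun ω _ => boltzmann_nonneg β hq E J ω) hZ hZ'

lemma log_le_mean_logWeightRatio :
    Real.log (partitionFunction (interaction β') q E π J) -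
        Real.log (partitionFunction (interaction β) q E π J) ≤
      mean β' q E π J (logWeightRatio β β' E J) := by
  have hZ := partitionFunction_pos β hq E π J
  have hZ' := partitionFunction_pos β' hq E π J
  rw [partitionFunction_eq] at hZ hZ'
  have hinv (ω : Config d) : boltzmann (interaction β) q E J ω =
      boltzmann (interaction β') q E J ω * Real.exp (-logWeightRatio β β' E J ω) := by
    rw [boltzmann_eq_mul_exp hβ h E J, mul_assoc, ← Real.exp_add, add_neg_cancel, Real.exp_zero,
      mul_one]
  simp_rw [hinv] at hZ
  have key := sum_mul_div_le_log _ _ _ (fun ω _ => boltzmann_nonneg β' hq E J ω) hZ' hZ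
  simp_rw [← hinv] at key
  rw [mean_eq, partitionFunction_eq, partitionFunction_eq]
  simp_rw [mul_neg, Finset.sum_neg_distrib, neg_div] at key
  linarith

end Pressure

lemma partitionFunction_wired_le_free {q : ℝ} (hq : 1 ≤ q) (β : ℝ≥0) (E : Finset (Edge d))
    (J : Media d) :
    partitionFunction (interaction β) q E (wired d) J ≤
      partitionFunction (interaction β) q E (free d) J := by
  unfold partitionFunction
  refine Finset.sum_le_sum fun A _ => mul_le_mul_of_nonneg_left ?_
    (Finset.prod_nonneg fun e _ => ?_)
  · rw [clusterCount_eq, clusterCount_eq]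
    refine pow_le_pow_right₀ hq (clusters_anti E fun e => ?_)
    unfold glue
    split_ifs
    exacts [le_rfl, Bool.false_le _]
  · split_ifs
    exacts [interaction_nonneg _ _, (one_sub_interaction_pos _ _).le]

/-- With all edges that touch `Λ` closed, the vertices of `Λ` are isolated. -/
lemma ncard_inter_le_clusters (Λ : Finset (Fin d → ℤ)) :
    (endpoints (edgesTouching Λ) ∩ Λ).ncard ≤
      clusters (edgesTouching Λ) (glue (edgesTouching Λ) (openOn ∅) (wired d)) := by
  set E := edgesTouching Λ
  set G := openGraph (glue E (openOn ∅) (wired d)) with hG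
  have hiso : ∀ x ∈ Λ, ∀ y, ¬ G.Adj x y := by
    intro x hx y hxy
    rw [hG, openGraph, SimpleGraph.fromEdgeSet_adj] at hxy
    obtain ⟨⟨e, he, ho⟩, -⟩ := hxy
    have heE : e ∈ E := mem_edgesTouching.mpr ⟨x, hx, by rw [he]; simp⟩
    simp [glue, heE, openOn] at ho
  have hinj : Set.InjOn G.connectedComponentMk (endpoints E ∩ Λ) := by
    intro x hx y _ hxy
    obtain ⟨w⟩ := SimpleGraph.ConnectedComponent.exact hxy
    cases w with
    | nil => rfl
    | cons hadj _ => exact absurd hadj (hiso x hx.2 _)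
  rw [← hinj.ncard_image]
  exact Set.ncard_le_ncard (Set.image_mono Set.inter_subset_left) ((finite_endpoints E).image _)

/-- The free boundary condition has at most one additional cluster for each endpoint outside
`Λ`. -/
lemma clusters_free_le (Λ : Finset (Fin d → ℤ)) {A : Finset (Edge d)} (hA : A ⊆ edgesTouching Λ) :
    clusters (edgesTouching Λ) (glue (edgesTouching Λ) (openOn A) (free d)) ≤
      clusters (edgesTouching Λ) (glue (edgesTouching Λ) (openOn A) (wired d)) +
        (endpoints (edgesTouching Λ) \ Λ).ncard := by
  set E := edgesTouching Λ
  have hle : glue E (openOn ∅) (free d) ≤ glue E (openOn ∅) (wired d) := fun e => by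
    unfold glue
    split_ifs
    exacts [le_rfl, Bool.false_le _]
  have hsup (π : Config d) : glue E (openOn ∅) π ⊔ openOn A = glue E (openOn A) π := by
    funext e
    by_cases he : e ∈ E
    · simp [glue, openOn, he]
    · have : e ∉ A := fun h => he (hA h)
      simp [glue, openOn, he, this]
  have h1 := clusters_sup_openOn_add_le hle A hA hA
  rw [hsup, hsup] at h1
  have h2 : (endpoints E ∩ Λ).ncard ≤ clusters E (glue E (openOn ∅) (wired d)) :=
    ncard_inter_le_clusters Λ
  have h3 : clusters E (glue E (openOn ∅) (free d)) ≤ (endpoints E).ncard :=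
    touchCount_le_ncard (finite_endpoints E) _
  have h4 := Set.ncard_inter_add_ncard_sdiff_eq_ncard (endpoints E) (Λ : Set (Fin d → ℤ))
    (finite_endpoints E)
  omega

lemma partitionFunction_free_le {q : ℝ} (hq : 1 ≤ q) (β : ℝ≥0) (Λ : Finset (Fin d → ℤ))
    (J : Media d) :
    partitionFunction (interaction β) q (edgesTouching Λ) (free d) J ≤
      partitionFunction (interaction β) q (edgesTouching Λ) (wired d) J *
        q ^ (endpoints (edgesTouching Λ) \ Λ).ncard := by
  unfold partitionFunction
  rw [Finset.sum_mul]
  refine Finset.sum_le_sum fun A hA => ?_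
  unfold weight
  rw [mul_assoc, ← pow_add, clusterCount_eq, clusterCount_eq]
  refine mul_le_mul_of_nonneg_left
    (pow_le_pow_right₀ hq (clusters_free_le Λ (Finset.mem_powerset.mp hA)))
    (Finset.prod_nonneg fun e _ => ?_)
  split_ifs
  exacts [interaction_nonneg _ _, (one_sub_interaction_pos _ _).le]

/-- The free and the wired pressure differ by a surface term, so the wired edge densities at `β`
are bounded by the free ones at `β' ≥ β` up to a surface term. -/
theorem sum_logOddsRatio_mul_wiredProb_le {q : ℝ} (hq : 1 ≤ q) {β β' : ℝ≥0} (hβ : 0 < β)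
    (h : β ≤ β') (Λ : Finset (Fin d → ℤ)) (J : Media d) :
    ∑ e ∈ edgesTouching Λ, logOddsRatio β β' (J e) * wiredProb β q J {e} ≤
      ∑ e ∈ edgesTouching Λ, logOddsRatio β β' (J e) * freeProb β' q J {e} +
        (endpoints (edgesTouching Λ) \ Λ).ncard * Real.log q := by
  set E := edgesTouching Λ
  have h1 := mean_logWeightRatio_le_log hq hβ h E (wired d) J
  have h2 := log_le_mean_logWeightRatio hq hβ h E (free d) J
  rw [mean_logWeightRatio hq] at h1 h2
  have h3 := Real.log_le_log (partitionFunction_pos β' hq E (wired d) J)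
    (partitionFunction_wired_le_free hq β' E J)
  have hZ := partitionFunction_pos β hq E (wired d) J
  have h4 := Real.log_le_log (partitionFunction_pos β hq E (free d) J)
    (partitionFunction_free_le hq β Λ J)
  rw [Real.log_mul hZ.ne' (by positivity), Real.log_pow] at h4
  have h5 : ∑ e ∈ E, logOddsRatio β β' (J e) * wiredProb β q J {e} ≤
      ∑ e ∈ E, logOddsRatio β β' (J e) * mean β q E (wired d) J (allOpen {e}) :=
    Finset.sum_le_sum fun e _ => mul_le_mul_of_nonneg_left (wiredProb_le_mean hq β J {e} E)
      (logOddsRatio_nonneg hβ h _)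
  have h6 : ∑ e ∈ E, logOddsRatio β β' (J e) * mean β' q E (free d) J (allOpen {e}) ≤
      ∑ e ∈ E, logOddsRatio β β' (J e) * freeProb β' q J {e} :=
    Finset.sum_le_sum fun e _ => mul_le_mul_of_nonneg_left (mean_le_freeProb hq β' J {e} E)
      (logOddsRatio_nonneg hβ h _)
  linarith

end

section


/-! ### Translation invariance -/

variable {d : ℕ}

/-- The translation by `v` as an automorphism of the lattice. -/
def shift (v : Fin d → ℤ) : lattice d ≃g lattice d where
  toEquiv := Equiv.addRight v
  map_rel_iff' := by
    intro x y
    simp [lattice]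

/-- The translation by `v` of the edges. -/
def shiftEdge (v : Fin d → ℤ) : Edge d ≃ Edge d := (shift v).mapEdgeSet

lemma coe_shiftEdge (v : Fin d → ℤ) (e : Edge d) : (shiftEdge v e).1 = Sym2.map (· + v) e.1 := rfl

lemma add_mem_shiftEdge {v x : Fin d → ℤ} {e : Edge d} : x + v ∈ (shiftEdge v e).1 ↔ x ∈ e.1 := by
  rw [coe_shiftEdge, Sym2.mem_map]
  constructor
  · rintro ⟨y, hy, h⟩
    rwa [← add_right_cancel h]
  · exact fun h => ⟨x, h, rfl⟩

lemma edgesTouching_singleton (v : Fin d → ℤ) :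
    edgesTouching {v} = (edgesTouching {0}).map (shiftEdge v).toEmbedding := by
  ext e
  obtain ⟨e, rfl⟩ := (shiftEdge v).surjective e
  rw [Finset.mem_map_equiv, Equiv.symm_apply_apply, mem_edgesTouching, mem_edgesTouching]
  simpa using add_mem_shiftEdge (v := v) (x := 0) (e := e)

/-- A translated configuration has the translated open graph. -/
def openGraphShift (v : Fin d → ℤ) (ω : Config d) :
    openGraph (ω ∘ shiftEdge v) ≃g openGraph ω where
  toEquiv := Equiv.addRight v
  map_rel_iff' := by
    intro x y
    simp only [openGraph, SimpleGraph.fromEdgeSet_adj, Set.mem_ofPred_eq, Equiv.coe_addRight, ne_eq,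
      add_left_inj, Function.comp_apply]
    refine and_congr_left fun _ => ⟨?_, ?_⟩
    · rintro ⟨e, he, ho⟩
      obtain ⟨e, rfl⟩ := (shiftEdge v).surjective e
      refine ⟨e, ?_, ho⟩
      rw [coe_shiftEdge] at he
      exact Sym2.map.injective (add_left_injective v) (by rw [he]; rfl)
    · rintro ⟨e, he, ho⟩
      exact ⟨shiftEdge v e, by rw [coe_shiftEdge, he]; rfl, ho⟩

lemma touchCount_image {α α' : Type*} {G : SimpleGraph α} {G' : SimpleGraph α'} (φ : G ≃g G')
    (V : Set α) : touchCount (φ '' V) G' = touchCount V G := by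
  have : G'.connectedComponentMk '' (φ '' V) =
      φ.connectedComponentEquiv '' (G.connectedComponentMk '' V) := by
    rw [Set.image_image, Set.image_image]
    rfl
  unfold touchCount
  rw [this, Set.ncard_image_of_injective _ φ.connectedComponentEquiv.injective]

lemma endpoints_map (v : Fin d → ℤ) (E : Finset (Edge d)) :
    endpoints (E.map (shiftEdge v).toEmbedding) = (· + v) '' endpoints E := by
  ext x
  constructor
  · rintro ⟨e, he, hx⟩
    obtain ⟨e, he', rfl⟩ := Finset.mem_map.mp he
    refine ⟨x - v, ⟨e, he', ?_⟩, by simp⟩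
    rw [← add_mem_shiftEdge (v := v), sub_add_cancel]
    exact hx
  · rintro ⟨x, ⟨e, he, hx⟩, rfl⟩
    exact ⟨shiftEdge v e, Finset.mem_map_of_mem _ he, add_mem_shiftEdge.mpr hx⟩

lemma clusters_map (v : Fin d → ℤ) (E : Finset (Edge d)) (ω : Config d) :
    clusters (E.map (shiftEdge v).toEmbedding) ω = clusters E (ω ∘ shiftEdge v) := by
  unfold clusters
  rw [endpoints_map]
  exact touchCount_image (openGraphShift v ω) _

lemma glue_map (v : Fin d → ℤ) (E A : Finset (Edge d)) (c : Bool) :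
    glue (E.map (shiftEdge v).toEmbedding) (openOn (A.map (shiftEdge v).toEmbedding))
      (fun _ => c) ∘ shiftEdge v = glue E (openOn A) fun _ => c := by
  funext e
  simp [glue, openOn]

lemma weight_map (p : unitInterval → ℝ) (q : ℝ) (v : Fin d → ℤ) (E A : Finset (Edge d)) (c : Bool)
    (J : Media d) :
    weight p q (E.map (shiftEdge v).toEmbedding) (fun _ => c) J
      (openOn (A.map (shiftEdge v).toEmbedding)) =
      weight p q E (fun _ => c) (J ∘ shiftEdge v) (openOn A) := by
  unfold weight
  rw [clusterCount_eq, clusterCount_eq, clusters_map, glue_map, Finset.prod_map]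
  simp [openOn]

lemma mean_map (β : ℝ≥0) (q : ℝ) (v : Fin d → ℤ) (E A : Finset (Edge d)) (c : Bool)
    (J : Media d) :
    mean β q (E.map (shiftEdge v).toEmbedding) (fun _ => c) J
      (allOpen (A.map (shiftEdge v).toEmbedding)) =
      mean β q E (fun _ => c) (J ∘ shiftEdge v) (allOpen A) := by
  have hallOpen (ω : Config d) :
      allOpen (A.map (shiftEdge v).toEmbedding) ω = allOpen A (ω ∘ shiftEdge v) := by
    simp [allOpen]
  have hsum (F : Finset (Edge d) → ℝ) :
      ∑ B ∈ (E.map (shiftEdge v).toEmbedding).powerset, F B =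
        ∑ B ∈ E.powerset, F (B.map (shiftEdge v).toEmbedding) :=
    (Finset.sum_equiv (shiftEdge v).finsetCongr (fun B => by simp) fun B _ => rfl).symm
  unfold mean partitionFunction
  rw [hsum, hsum]
  simp_rw [weight_map, hallOpen, glue_map]

lemma freeProb_map (β : ℝ≥0) (q : ℝ) (v : Fin d → ℤ) (A : Finset (Edge d)) (J : Media d) :
    freeProb β q J (A.map (shiftEdge v).toEmbedding) = freeProb β q (J ∘ shiftEdge v) A :=
  (Equiv.iSup_congr (shiftEdge v).finsetCongr fun E => mean_map β q v E A false J).symm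

lemma wiredProb_map (β : ℝ≥0) (q : ℝ) (v : Fin d → ℤ) (A : Finset (Edge d)) (J : Media d) :
    wiredProb β q J (A.map (shiftEdge v).toEmbedding) = wiredProb β q (J ∘ shiftEdge v) A :=
  (Equiv.iInf_congr (shiftEdge v).finsetCongr fun E => mean_map β q v E A true J).symm

lemma measurePreserving_comp_shiftEdge (ρ : Measure unitInterval) [IsProbabilityMeasure ρ]
    (v : Fin d → ℤ) :
    MeasurePreserving (fun J : Media d => J ∘ shiftEdge v) (mediaLaw d ρ) (mediaLaw d ρ) :=
  ⟨by fun_prop, Measure.map_infinitePi_infinitePi_of_inj (shiftEdge v).injective⟩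

lemma integral_shiftEdge (ρ : Measure unitInterval) [IsProbabilityMeasure ρ] (v : Fin d → ℤ)
    {H : Media d → Edge d → ℝ} (hH : ∀ e, Measurable fun J => H J e)
    (hcov : ∀ J e, H J (shiftEdge v e) = H (J ∘ shiftEdge v) e) (e : Edge d) :
    ∫ J, H J (shiftEdge v e) ∂(mediaLaw d ρ) = ∫ J, H J e ∂(mediaLaw d ρ) := by
  simp_rw [hcov]
  have hm := measurePreserving_comp_shiftEdge ρ v
  conv_rhs => rw [← hm.map_eq]
  exact (integral_map hm.measurable.aemeasurable (hH e).aestronglyMeasurable).symm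

/-! ### Surface terms are negligible -/

lemma abs_sub_le_one_of_mem {e : Edge d} {x y : Fin d → ℤ} (hx : x ∈ e.1) (hy : y ∈ e.1)
    (i : Fin d) : |x i - y i| ≤ 1 := by
  by_cases hxy : x = y
  · simp [hxy]
  have he : e.1 = s(x, y) := (Sym2.mem_and_mem_iff hxy).mp ⟨hx, hy⟩
  have hadj : ∑ i, (x i - y i) ^ 2 = 1 := by
    have := e.2
    rw [he] at this
    exact this
  have : (x i - y i) ^ 2 ≤ 1 := by
    rw [← hadj]
    exact Finset.single_le_sum (f := fun i => (x i - y i) ^ 2) (fun i _ => sq_nonneg _)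
      (Finset.mem_univ i)
  exact (sq_le_one_iff_abs_le_one _).mp this

lemma card_symBox (N : ℕ) : (symBox d N).card = (2 * N + 1) ^ d := by
  rw [symBox, Pi.card_Icc]
  simp only [Int.card_Icc, Finset.prod_const, Finset.card_univ, Fintype.card_fin]
  congr 1
  omega

lemma symBox_subset (N : ℕ) : symBox d N ⊆ symBox d (N + 1) := fun x hx =>
  mem_symBox.mpr fun i => (mem_symBox.mp hx i).trans (by push_cast; linarith)

lemma ncard_endpoints_sdiff_le (N : ℕ) :
    ((endpoints (edgesTouching (symBox d N)) \ symBox d N).ncard : ℝ) ≤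
      (2 * (N : ℝ) + 3) ^ d - (2 * N + 1) ^ d := by
  classical
  have hsub : endpoints (edgesTouching (symBox d N)) \ symBox d N ⊆
      (symBox d (N + 1) \ symBox d N : Finset (Fin d → ℤ)) := by
    rintro y ⟨⟨e, he, hy⟩, hyN⟩
    rw [Finset.coe_sdiff]
    refine ⟨?_, hyN⟩
    obtain ⟨x, hx, hxe⟩ := mem_edgesTouching.mp he
    refine mem_symBox.mpr fun i => ?_
    have h1 := abs_le.mp (abs_sub_le_one_of_mem hxe hy i)
    have h2 := abs_le.mp (mem_symBox.mp hx i)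
    rw [abs_le]
    push_cast
    constructor <;> linarith
  have h := Set.ncard_le_ncard hsub (Finset.finite_toSet _)
  rw [Set.ncard_coe_finset] at h
  have h2 := Finset.card_sdiff_add_card_eq_card (symBox_subset (d := d) N)
  rw [card_symBox, card_symBox] at h2
  have h3 : ((symBox d (N + 1) \ symBox d N).card : ℝ) + (2 * N + 1) ^ d =
      (2 * ((N + 1 : ℕ) : ℝ) + 1) ^ d := by exact_mod_cast h2
  have h4 : (2 * ((N + 1 : ℕ) : ℝ) + 1) = 2 * N + 3 := by push_cast; ring
  rw [h4] at h3
  have h5 : ((endpoints (edgesTouching (symBox d N)) \ symBox d N).ncard : ℝ) ≤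
    (symBox d (N + 1) \ symBox d N).card := by exact_mod_cast h
  linarith

lemma card_filter_mem_le_two (Λ : Finset (Fin d → ℤ)) (e : Edge d)
    [DecidablePred fun x : Fin d → ℤ => x ∈ e.1] : (Λ.filter fun x => x ∈ e.1).card ≤ 2 := by
  classical
  obtain ⟨x, y, hxy⟩ : ∃ x y, e.1 = s(x, y) := by
    induction h : e.1 with
    | _ x y => exact ⟨x, y, rfl⟩
  refine (Finset.card_le_card (t := {x, y}) fun z hz => ?_).trans Finset.card_le_two
  have := (Finset.mem_filter.mp hz).2
  rw [hxy, Sym2.mem_iff] at this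
  simpa using this

/-- If the box sums of a bounded translation invariant function of the edges are at most of surface
order, then its sum over the edges at the origin is not positive. -/
lemma sum_edgesTouching_zero_nonpos {δ : Edge d → ℝ} {K c : ℝ}
    (hinv : ∀ v e, δ (shiftEdge v e) = δ e) (hK : ∀ e, |δ e| ≤ K) (hK0 : 0 ≤ K) (hc : 0 ≤ c)
    (hδ : ∀ N : ℕ, ∑ e ∈ edgesTouching (symBox d N), δ e ≤
      (endpoints (edgesTouching (symBox d N)) \ symBox d N).ncard * c) :
    ∑ e ∈ edgesTouching {0}, δ e ≤ 0 := by
  classical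
  set D := ∑ e ∈ edgesTouching {0}, δ e
  set s := (edgesTouching {(0 : Fin d → ℤ)}).card
  have key (N : ℕ) : (2 * (N : ℝ) + 1) ^ d * D ≤
      ((2 * (N : ℝ) + 3) ^ d - (2 * N + 1) ^ d) * (2 * c + 2 * K * s) := by
    set Λ := symBox d N
    set E := edgesTouching Λ
    set m := (endpoints E \ Λ).ncard with hm
    have hstar (x : Fin d → ℤ) : ∑ e ∈ edgesTouching {x}, δ e = D := by
      rw [edgesTouching_singleton, Finset.sum_map]
      exact Finset.sum_congr rfl fun e _ => hinv x e
    -- Every edge inside the box is counted at both of its endpoints.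
    have hdouble : (2 * (N : ℝ) + 1) ^ d * D =
        ∑ e ∈ E, ((Λ.filter fun x => x ∈ e.1).card : ℝ) * δ e := by
      calc (2 * (N : ℝ) + 1) ^ d * D = ∑ x ∈ Λ, ∑ e ∈ edgesTouching {x}, δ e := by
            simp_rw [hstar]
            rw [Finset.sum_const, nsmul_eq_mul, card_symBox]
            push_cast
            rfl
        _ = ∑ e ∈ E, ∑ x ∈ Λ.filter (fun x => x ∈ e.1), δ e := by
            refine Finset.sum_comm' fun x e => ?_
            simp only [E, mem_edgesTouching, Finset.mem_singleton, Finset.mem_filter]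
            constructor
            · rintro ⟨hx, y, hy, hxe⟩
              subst hy
              exact ⟨⟨hx, hxe⟩, _, hx, hxe⟩
            · rintro ⟨⟨hx, hxe⟩, -⟩
              exact ⟨hx, x, rfl, hxe⟩
        _ = _ := Finset.sum_congr rfl fun e _ => by rw [Finset.sum_const, nsmul_eq_mul]
    have hterm (e : Edge d) : ((Λ.filter fun x => x ∈ e.1).card : ℝ) * δ e ≤
        2 * δ e + if ∃ y ∈ e.1, y ∉ Λ then 2 * K else 0 := by
      have hle : ((Λ.filter fun x => x ∈ e.1).card : ℝ) ≤ 2 := by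
        exact_mod_cast card_filter_mem_le_two Λ e
      have h0 : (0 : ℝ) ≤ ((Λ.filter fun x => x ∈ e.1).card : ℝ) := Nat.cast_nonneg _
      split_ifs with hy
      · have := abs_le.mp (hK e)
        nlinarith
      · push Not at hy
        have : (Λ.filter fun x => x ∈ e.1).card = 2 := by
          obtain ⟨x, y, hxy⟩ : ∃ x y, e.1 = s(x, y) := by
            induction h : e.1 with
            | _ x y => exact ⟨x, y, rfl⟩
          have hne : x ≠ y := by
            have := e.2
            rw [hxy] at this
            exact ((SimpleGraph.mem_edgeSet _).mp this).ne
          rw [Finset.card_eq_two]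
          refine ⟨x, y, hne, ?_⟩
          ext z
          have hz : z ∈ e.1 ↔ z = x ∨ z = y := by rw [hxy, Sym2.mem_iff]
          simp only [Finset.mem_filter, Finset.mem_insert, Finset.mem_singleton, ← hz]
          exact ⟨fun h => h.2, fun h => ⟨hy z h, h⟩⟩
        rw [this]
        simp
    have hbdry : ((E.filter fun e => ∃ y ∈ e.1, y ∉ Λ).card : ℝ) ≤ m * s := by
      have hfin : (endpoints E \ (Λ : Set (Fin d → ℤ))).Finite := (finite_endpoints E).sdiff
      have hsub : (E.filter fun e => ∃ y ∈ e.1, y ∉ Λ) ⊆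
          hfin.toFinset.biUnion fun y => edgesTouching {y} := by
        intro e he
        obtain ⟨heE, y, hy, hyΛ⟩ := Finset.mem_filter.mp he
        refine Finset.mem_biUnion.mpr ⟨y, hfin.mem_toFinset.mpr ⟨⟨e, heE, hy⟩, hyΛ⟩, ?_⟩
        exact mem_edgesTouching.mpr ⟨y, by simp, hy⟩
      have h1 := (Finset.card_le_card hsub).trans (Finset.card_biUnion_le_card_mul _ _ s
        fun y _ => by rw [edgesTouching_singleton, Finset.card_map])
      rw [← Set.ncard_eq_toFinset_card _ hfin] at h1
      exact_mod_cast h1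
    have hm' : (m : ℝ) ≤ (2 * (N : ℝ) + 3) ^ d - (2 * N + 1) ^ d := ncard_endpoints_sdiff_le N
    calc (2 * (N : ℝ) + 1) ^ d * D
        ≤ ∑ e ∈ E, (2 * δ e + if ∃ y ∈ e.1, y ∉ Λ then 2 * K else 0) := by
          rw [hdouble]
          exact Finset.sum_le_sum fun e _ => hterm e
      _ = 2 * ∑ e ∈ E, δ e + (E.filter fun e => ∃ y ∈ e.1, y ∉ Λ).card * (2 * K) := by
          rw [Finset.sum_add_distrib, ← Finset.mul_sum, ← Finset.sum_filter, Finset.sum_const,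
            nsmul_eq_mul]
      _ ≤ 2 * (m * c) + (m * s) * (2 * K) :=
          add_le_add (mul_le_mul_of_nonneg_left (hδ N) (by norm_num))
            (mul_le_mul_of_nonneg_right hbdry (by positivity))
      _ = m * (2 * c + 2 * K * s) := by ring
      _ ≤ _ := mul_le_mul_of_nonneg_right hm' (by positivity)
  have hlim : Tendsto (fun N : ℕ => ((1 + 2 / (2 * (N : ℝ) + 1)) ^ d - 1) * (2 * c + 2 * K * s))
      atTop (𝓝 (((1 + 0) ^ d - 1) * (2 * c + 2 * K * s))) := by
    have h1 : Tendsto (fun N : ℕ => 2 * (N : ℝ) + 1) atTop atTop :=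
      tendsto_atTop_add_const_right _ _
        (tendsto_natCast_atTop_atTop.const_mul_atTop (by norm_num))
    exact ((((h1.const_div_atTop 2).const_add 1).pow d).sub_const 1).mul_const _
  rw [add_zero, one_pow, sub_self, zero_mul] at hlim
  refine ge_of_tendsto' hlim fun N => ?_
  have hpos : (0 : ℝ) < 2 * N + 1 := by positivity
  have e1 : 1 + 2 / (2 * (N : ℝ) + 1) = (2 * N + 3) / (2 * N + 1) := by field_simp; ring
  have e2 : ((2 * (N : ℝ) + 3) / (2 * N + 1)) ^ d - 1 =
      ((2 * (N : ℝ) + 3) ^ d - (2 * N + 1) ^ d) / (2 * N + 1) ^ d := by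
    rw [div_pow, div_sub_one (by positivity)]
  rw [e1, e2, div_mul_eq_mul_div, le_div_iff₀ (by positivity), mul_comm]
  exact key N

end

section


/-! ### Uniqueness at continuity points of the wired edge density -/

variable {d : ℕ} (ρ : Measure unitInterval) [IsProbabilityMeasure ρ] {q : ℝ} (hq : 1 ≤ q)

lemma integrable_of_measurable_of_abs_le {f : Media d → ℝ} (hf : Measurable f) {C : ℝ}
    (h : ∀ J, |f J| ≤ C) : Integrable f (mediaLaw d ρ) :=
  Integrable.of_bound hf.aestronglyMeasurable C (ae_of_all _ h)

include hq in
lemma integrable_wiredProb (β : ℝ≥0) (A : Finset (Edge d)) :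
    Integrable (fun J => wiredProb β q J A) (mediaLaw d ρ) :=
  integrable_of_measurable_of_abs_le ρ (measurable_wiredProb β A q) (C := 1) fun J => by
    rw [abs_of_nonneg (wiredProb_nonneg hq β J A)]
    exact wiredProb_le_one hq β J A

section Bounds

variable {β β' : ℝ≥0} (hβ : 0 < β) (h : β ≤ β')

lemma measurable_logOddsRatio_apply (β β' : ℝ≥0) (e : Edge d) :
    Measurable fun J : Media d => logOddsRatio β β' (J e) :=
  (measurable_logOddsRatio β β').comp (measurable_pi_apply e)

include hβ h in
lemma integrable_logOddsRatio_mul {g : Media d → ℝ} (hg : Measurable g) (h0 : ∀ J, 0 ≤ g J)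
    (h1 : ∀ J, g J ≤ 1) (e : Edge d) :
    Integrable (fun J => logOddsRatio β β' (J e) * g J) (mediaLaw d ρ) :=
  integrable_of_measurable_of_abs_le ρ ((measurable_logOddsRatio_apply β β' e).mul hg)
    fun J => by
      rw [abs_of_nonneg (mul_nonneg (logOddsRatio_nonneg hβ h _) (h0 J))]
      exact (mul_le_of_le_one_right (logOddsRatio_nonneg hβ h _) (h1 J)).trans
        (logOddsRatio_le hβ h _)

include hq hβ h in
/-- Summed over the edges at the origin, the wired edge densities at `β`, weighted with the
logarithmic odds ratios, are bounded by the free ones at `β' ≥ β`. -/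
lemma sum_integral_logOddsRatio_nonpos :
    ∑ e ∈ edgesTouching {(0 : Fin d → ℤ)}, ∫ J, (logOddsRatio β β' (J e) * wiredProb β q J {e} -
      logOddsRatio β β' (J e) * freeProb β' q J {e}) ∂(mediaLaw d ρ) ≤ 0 := by
  have hw (e : Edge d) := integrable_logOddsRatio_mul ρ hβ h (measurable_wiredProb β {e} q)
    (fun J => wiredProb_nonneg hq β J {e}) (fun J => wiredProb_le_one hq β J {e}) e
  have hf (e : Edge d) := integrable_logOddsRatio_mul ρ hβ h (measurable_freeProb β' {e} q)
    (fun J => freeProb_nonneg hq β' J {e}) (fun J => freeProb_le_one hq β' J {e}) e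
  have hsub (e : Edge d) : Integrable (fun J => logOddsRatio β β' (J e) * wiredProb β q J {e} -
      logOddsRatio β β' (J e) * freeProb β' q J {e}) (mediaLaw d ρ) := (hw e).sub (hf e)
  have hC : (0 : ℝ) ≤ ((β' : ℝ) - β) * (Real.exp β' / β) :=
    mul_nonneg (sub_nonneg.mpr (by exact_mod_cast h)) (by positivity)
  refine sum_edgesTouching_zero_nonpos (K := ((β' : ℝ) - β) * (Real.exp β' / β))
    (c := Real.log q) ?_ ?_ hC (Real.log_nonneg hq) ?_
  · intro v e
    refine integral_shiftEdge ρ v (H := fun J e => logOddsRatio β β' (J e) * wiredProb β q J {e} -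
      logOddsRatio β β' (J e) * freeProb β' q J {e}) (fun e => ?_) (fun J e => ?_) e
    · exact ((measurable_logOddsRatio_apply β β' e).mul (measurable_wiredProb β {e} q)).sub
        ((measurable_logOddsRatio_apply β β' e).mul (measurable_freeProb β' {e} q))
    · have h1 := wiredProb_map β q v {e} J
      have h2 := freeProb_map β' q v {e} J
      rw [Finset.map_singleton] at h1 h2
      rw [← h1, ← h2]
      rfl
  · intro e
    have hbound : ∀ J, ‖logOddsRatio β β' (J e) * wiredProb β q J {e} -
        logOddsRatio β β' (J e) * freeProb β' q J {e}‖ ≤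
        ((β' : ℝ) - β) * (Real.exp β' / β) := by
      intro J
      have hl := logOddsRatio_nonneg hβ h (J e)
      rw [← mul_sub, Real.norm_eq_abs, abs_mul, abs_of_nonneg hl]
      refine (mul_le_of_le_one_right hl ?_).trans (logOddsRatio_le hβ h _)
      rw [abs_le]
      constructor <;> linarith [wiredProb_nonneg hq β J {e}, wiredProb_le_one hq β J {e},
        freeProb_nonneg hq β' J {e}, freeProb_le_one hq β' J {e}]
    simpa using norm_integral_le_of_norm_le_const (μ := mediaLaw d ρ) (ae_of_all _ hbound)
  · intro N
    rw [← integral_finsetSum _ fun e _ => hsub e]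
    have hle := integral_mono (μ := mediaLaw d ρ)
      (integrable_finsetSum (edgesTouching (symBox d N)) fun e _ => hsub e)
      (integrable_const
        ((endpoints (edgesTouching (symBox d N)) \ symBox d N).ncard * Real.log q))
      fun J => by
        have := sum_logOddsRatio_mul_wiredProb_le hq hβ h (symBox d N) J
        simp only [Finset.sum_sub_distrib]
        linarith
    simpa using hle

end Bounds

/-- The mean number of open edges at the origin in the wired infinite-volume measure. -/
def wiredDensity (d : ℕ) (q : ℝ) (β : ℝ≥0) : ℝ :=
  ∑ e ∈ edgesTouching {(0 : Fin d → ℤ)}, ∫ J, wiredProb β q J {e} ∂(mediaLaw d ρ)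

include hq in
lemma monotone_wiredDensity : Monotone (wiredDensity ρ d q) := fun _ _ h =>
  Finset.sum_le_sum fun e _ => integral_mono (integrable_wiredProb ρ hq _ _)
    (integrable_wiredProb ρ hq _ _) fun J => monotone_wiredProb hq J {e} h

include hq in
lemma wiredProb_eq_zero (β : ℝ≥0) {J : Media d} {e : Edge d} (he : J e = 0) :
    wiredProb β q J {e} = 0 := by
  refine le_antisymm ?_ (wiredProb_nonneg hq β J _)
  refine (wiredProb_le_mean hq β J {e} {e}).trans_eq ?_
  unfold mean
  rw [Finset.sum_eq_zero, zero_div]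
  intro A _
  rw [allOpen_glue le_rfl, allOpen_singleton]
  by_cases hA : openOn A e = true
  · have : weight (interaction β) q {e} (wired d) J (openOn A) = 0 := by
      simp [weight, hA, he, interaction]
    rw [this, zero_mul]
  · rw [if_neg hA, mul_zero]

include hq in
lemma integrable_mul_wiredProb_sub_freeProb (β : ℝ≥0) (e : Edge d) :
    Integrable (fun J : Media d => (J e : ℝ) * (wiredProb β q J {e} - freeProb β q J {e}))
      (mediaLaw d ρ) := by
  refine integrable_of_measurable_of_abs_le ρ ((measurable_subtype_coe.comp
    (measurable_pi_apply e)).mul ((measurable_wiredProb β {e} q).sub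
      (measurable_freeProb β {e} q))) (C := 1) fun J => ?_
  have h1 := freeProb_le_wiredProb hq β J {e}
  rw [abs_of_nonneg (mul_nonneg (J e).2.1 (sub_nonneg.mpr h1))]
  exact mul_le_one₀ (J e).2.2 (sub_nonneg.mpr h1)
    (by linarith [wiredProb_le_one hq β J {e}, freeProb_nonneg hq β J {e}])

/-- Comparing the free density at `β₀` with the wired density at a slightly smaller `β` bounds the
gap between wired and free at `β₀` by the increment of the wired density. -/
lemma sum_integral_mul_sub_le (hq : 1 ≤ q) {β β₀ : ℝ≥0} (hβ : 0 < β) (h : β < β₀) :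
    ∑ e ∈ edgesTouching {(0 : Fin d → ℤ)},
      ∫ J, (J e : ℝ) * (wiredProb β₀ q J {e} - freeProb β₀ q J {e}) ∂(mediaLaw d ρ) ≤
      Real.exp β₀ / β * (wiredDensity ρ d q β₀ - wiredDensity ρ d q β) := by
  have hε : (0 : ℝ) < (β₀ : ℝ) - β := sub_pos.mpr (by exact_mod_cast h)
  have hint := integrable_mul_wiredProb_sub_freeProb (d := d) ρ hq β₀
  have hw := integrable_wiredProb (d := d) ρ hq
  have hlw (e : Edge d) := integrable_logOddsRatio_mul ρ hβ h.le (measurable_wiredProb β {e} q)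
    (fun J => wiredProb_nonneg hq β J {e}) (fun J => wiredProb_le_one hq β J {e}) e
  have hlf (e : Edge d) := integrable_logOddsRatio_mul ρ hβ h.le (measurable_freeProb β₀ {e} q)
    (fun J => freeProb_nonneg hq β₀ J {e}) (fun J => freeProb_le_one hq β₀ J {e}) e
  have hdw (e : Edge d) : Integrable (fun J => ((β₀ : ℝ) - β) * (Real.exp β₀ / β) *
      (wiredProb β₀ q J {e} - wiredProb β q J {e})) (mediaLaw d ρ) :=
    ((hw _ _).sub (hw _ _)).const_mul _
  have hl (e : Edge d) : Integrable (fun J => logOddsRatio β β₀ (J e) * wiredProb β q J {e} -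
      logOddsRatio β β₀ (J e) * freeProb β₀ q J {e}) (mediaLaw d ρ) := (hlw e).sub (hlf e)
  have hterm (e : Edge d) :
      ((β₀ : ℝ) - β) *
        ∫ J, (J e : ℝ) * (wiredProb β₀ q J {e} - freeProb β₀ q J {e}) ∂(mediaLaw d ρ) ≤
      ((β₀ : ℝ) - β) * (Real.exp β₀ / β) *
        (∫ J, wiredProb β₀ q J {e} ∂(mediaLaw d ρ) - ∫ J, wiredProb β q J {e} ∂(mediaLaw d ρ)) +
      ∫ J, (logOddsRatio β β₀ (J e) * wiredProb β q J {e} -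
        logOddsRatio β β₀ (J e) * freeProb β₀ q J {e}) ∂(mediaLaw d ρ) := by
    rw [← integral_sub (hw _ _) (hw _ _), ← integral_const_mul, ← integral_const_mul,
      ← integral_add (hdw e) (hl e)]
    refine integral_mono ((hint e).const_mul _) ((hdw e).add (hl e)) fun J => ?_
    have h1 := mul_le_mul_of_nonneg_right (mul_le_logOddsRatio hβ h.le (J e))
      (sub_nonneg.mpr (freeProb_le_wiredProb hq β₀ J {e}))
    have h2 := mul_le_mul_of_nonneg_right (logOddsRatio_le hβ h.le (J e))
      (sub_nonneg.mpr (monotone_wiredProb hq J {e} h.le))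
    simp only at h1 h2 ⊢
    linarith
  have hsum := Finset.sum_le_sum fun e (_ : e ∈ edgesTouching {(0 : Fin d → ℤ)}) => hterm e
  rw [← Finset.mul_sum, Finset.sum_add_distrib, ← Finset.mul_sum, Finset.sum_sub_distrib] at hsum
  have hneg := sum_integral_logOddsRatio_nonpos (d := d) ρ hq hβ h.le
  refine le_of_mul_le_mul_left (hsum.trans ?_) hε
  unfold wiredDensity
  linarith

/-- At a continuity point of the wired density the free and the wired edge probabilities agree for
almost all media. -/
theorem ae_wiredProb_eq_freeProb (hq : 1 ≤ q) {β₀ : ℝ≥0} (hβ₀ : 0 < β₀)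
    (hcont : ContinuousAt (wiredDensity ρ d q) β₀) (e : Edge d) :
    ∀ᵐ J ∂(mediaLaw d ρ), wiredProb β₀ q J {e} = freeProb β₀ q J {e} := by
  have hnonneg (e : Edge d) (J : Media d) : 0 ≤ wiredProb β₀ q J {e} - freeProb β₀ q J {e} :=
    sub_nonneg.mpr (freeProb_le_wiredProb hq β₀ J {e})
  have hnonneg' (e : Edge d) (J : Media d) :
      0 ≤ (J e : ℝ) * (wiredProb β₀ q J {e} - freeProb β₀ q J {e}) :=
    mul_nonneg (J e).2.1 (hnonneg e J)
  have hsum : ∑ e ∈ edgesTouching {(0 : Fin d → ℤ)},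
      ∫ J, (J e : ℝ) * (wiredProb β₀ q J {e} - freeProb β₀ q J {e}) ∂(mediaLaw d ρ) ≤ 0 := by
    have hlim : Tendsto (fun β : ℝ≥0 =>
        Real.exp β₀ / β * (wiredDensity ρ d q β₀ - wiredDensity ρ d q β)) (𝓝[<] β₀)
        (𝓝 (Real.exp β₀ / β₀ * (wiredDensity ρ d q β₀ - wiredDensity ρ d q β₀))) := by
      refine Tendsto.mono_left ?_ nhdsWithin_le_nhds
      exact (tendsto_const_nhds.div (NNReal.continuous_coe.tendsto β₀)
        (by exact_mod_cast hβ₀.ne')).mul (hcont.tendsto.const_sub _)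
    rw [sub_self, mul_zero] at hlim
    have : (𝓝[<] β₀).NeBot := nhdsLT_neBot_of_exists_lt ⟨0, hβ₀⟩
    refine ge_of_tendsto hlim ?_
    filter_upwards [self_mem_nhdsWithin, nhdsWithin_le_nhds (lt_mem_nhds hβ₀)] with β h1 h2
    exact sum_integral_mul_sub_le ρ hq h2 h1
  have hzero := (Finset.sum_eq_zero_iff_of_nonneg fun e _ =>
    integral_nonneg (hnonneg' e)).mp (hsum.antisymm (Finset.sum_nonneg fun e _ =>
      integral_nonneg (hnonneg' e)))
  have hstar : ∀ e ∈ edgesTouching {(0 : Fin d → ℤ)},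
      ∀ᵐ J ∂(mediaLaw d ρ), wiredProb β₀ q J {e} = freeProb β₀ q J {e} := by
    intro e he
    have hint := integrable_mul_wiredProb_sub_freeProb ρ hq β₀ e
    filter_upwards [(integral_eq_zero_iff_of_nonneg (hnonneg' e) hint).mp (hzero e he)] with J hJ
    by_cases h0 : J e = 0
    · -- Where `J e` vanishes, the edge is closed for either boundary condition.
      have h1 := wiredProb_eq_zero hq β₀ h0
      exact le_antisymm (h1 ▸ freeProb_nonneg hq β₀ J {e}) (freeProb_le_wiredProb hq β₀ J {e})
    · have h1 : (J e : ℝ) ≠ 0 := fun h => h0 (Subtype.ext h)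
      exact sub_eq_zero.mp ((mul_eq_zero.mp hJ).resolve_left h1)
  -- Every edge is a translate of an edge at the origin.
  obtain ⟨v, hv⟩ : ∃ v, v ∈ e.1 := by
    induction h : e.1 with
    | _ x y => exact ⟨x, by simp⟩
  have he : e ∈ edgesTouching {v} := mem_edgesTouching.mpr ⟨v, by simp, hv⟩
  rw [edgesTouching_singleton] at he
  obtain ⟨e₀, he₀, rfl⟩ := Finset.mem_map.mp he
  have hmp := measurePreserving_comp_shiftEdge ρ v
  filter_upwards [hmp.quasiMeasurePreserving.ae (hstar e₀ he₀)] with J hJ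
  rw [← wiredProb_map, ← freeProb_map, Finset.map_singleton] at hJ
  exact hJ

end

end RandomFK

end

theorem theorem3 (d : ℕ) (hd : 1 ≤ d) (q : ℝ) (hq : 1 ≤ q)
    (ρ : Measure unitInterval) [IsProbabilityMeasure ρ] :
    (∀ β : ℝ≥0,
      (∃ Θf : ProbabilityMeasure (RandomFK.Media d × RandomFK.Config d),
        RandomFK.IsInfiniteVolumeLimit ρ hq β (RandomFK.free d) Θf) ∧
      (∃ Θw : ProbabilityMeasure (RandomFK.Media d × RandomFK.Config d),
        RandomFK.IsInfiniteVolumeLimit ρ hq β (RandomFK.wired d) Θw)) ∧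
    {β : ℝ≥0 | ∃ Θf Θw : ProbabilityMeasure (RandomFK.Media d × RandomFK.Config d),
      RandomFK.IsInfiniteVolumeLimit ρ hq β (RandomFK.free d) Θf ∧
      RandomFK.IsInfiniteVolumeLimit ρ hq β (RandomFK.wired d) Θw ∧
      Θf ≠ Θw}.Countable := by
  refine ⟨fun β => ⟨?_, ?_⟩, ?_⟩
  · exact RandomFK.exists_isInfiniteVolumeLimit ρ hq β
      fun J A => ⟨_, RandomFK.tendsto_integral_free hq β J A⟩
  · exact RandomFK.exists_isInfiniteVolumeLimit ρ hq β
      fun J A => ⟨_, RandomFK.tendsto_integral_wired hq β J A⟩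
  · refine ((Set.countable_singleton 0).union (RandomFK.monotone_wiredDensity
      (d := d) ρ hq).countable_not_continuousAt).mono ?_
    rintro β ⟨Θf, Θw, hf, hw, hne⟩
    by_contra hβ
    simp only [Set.mem_union, Set.mem_singleton_iff, Set.mem_ofPred_eq, not_or, not_not] at hβ
    refine hne (RandomFK.eq_of_isInfiniteVolumeLimit ρ hq β ?_ hf hw)
    filter_upwards [ae_all_iff.mpr fun e => RandomFK.ae_wiredProb_eq_freeProb ρ hq
      (pos_iff_ne_zero.mpr hβ.1) hβ.2 e] with J hJ A
    have h1 := RandomFK.wiredProb_sub_freeProb_le hq β J A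
    rw [Finset.sum_eq_zero fun e _ => sub_eq_zero.mpr (hJ e)] at h1
    have h2 := RandomFK.freeProb_le_wiredProb hq β J A
    have h3 := (RandomFK.tendsto_integral_free hq β J A).sub
      (RandomFK.tendsto_integral_wired hq β J A)
    rwa [show RandomFK.freeProb β q J A = RandomFK.wiredProb β q J A by linarith, sub_self] at h3
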